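/- Write $S^1=\mathbb{R}/2\pi\mathbb{Z}$. For $n\ge 0$ let $C^n(S^1;E)$ be the Banach space of $n$ times continuously differentiable maps $f\colon S^1\to E$ with norm $\max_{i\le n}\sup_\varphi\lVert f^{(i)}(\varphi)\rVert$, and write $\dot\gamma$ for the derivative of $\gamma$ with respect to $\varphi\in S^1$. Let $\mathrm{Diff}^k(S^1)$ be the group of $C^k$-diffeomorphisms of $S^1$ (homeomorphisms if $k=0$). A map $P$ from an open subset of a normed space $X$ into $\mathrm{Diff}^k(S^1)$ is called $\ell$ times continuously Fréchet differentiable if, near each point $x_0$ of its domain, $P(x)(\varphi)=P(x_0)(\varphi)+U(x)(\varphi)\bmod 2\pi$ with a map $U$ into $C^k(S^1;\mathbb{R})$ that is $\ell$ times continuously Fréchet differentiable near $x_0$ and satisfies $U(x_0)=0$; its derivative at $x_0$ is then $U'(x_0)\colon X\to C^k(S^1;\mathbb{R})$. Let $k\ge 0$ and $\ell\ge 1$ be integers, let $r>0$ and $R>r/2$, and let $\gamma_0(\varphi)=(R\cos\varphi,R\sin\varphi)$. Then there exists an open neighborhood $\mathcal{V}\subset C^{k+\ell+1}(S^1;\mathbb{R}^2)$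 of $\gamma_0$ such that the following hold. 1. For each $\gamma\in\mathcal{V}$ and $\varphi\in S^1$ the circle of radius $r$ centered at $\gamma(\varphi)$ intersects the curve $\gamma$ in exactly two points $\gamma(p_\gamma(\varphi))\ne\gamma(m_\gamma(\varphi))$, and $p_\gamma(\varphi)$, $m_\gamma(\varphi)$ are the only parameters $\psi\in S^1$ with $\lvert\gamma(\psi)-\gamma(\varphi)\rvert=r$. Here $p_\gamma(\varphi)$ is the next such parameter after $\varphi$, and $m_\gamma(\varphi)$ is the previous such parameter before $\varphi$, with respect to the positive orientation of $S^1$. 2. For each $\gamma\in\mathcal{V}$ the maps $p_\gamma$ and $m_\gamma$ belong to $\mathrm{Diff}^k(S^1)$, and the mappings $\gamma\mapsto p_\gamma$ and $\gamma\mapsto m_\gamma$ from $\mathcal{V}$ to $\mathrm{Diff}^k(S^1)$ are $\ell$ times continuously Fréchet differentiable. Their first derivatives at $\gamma\in\mathcal{V}$ in direction $\sigma\in C^{k+\ell+1}(S^1;\mathbb{R}^2)$ are given, for every $\varphi\in S^1$, by $$p_\gamma'(\sigma)(\varphi)=\frac{\langle\sigma(\varphi)-\sigma(p_\gamma(\varphi)),\,\gamma(p_\gamma(\varphi))-\gamma(\varphi)\rangle}{\langle\dot\gamma(p_\gamma(\varphi)),\,\gamma(p_\gamma(\varphi))-\gamma(\varphi)\rangle},\qquad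 m_\gamma'(\sigma)(\varphi)=\frac{\langle\sigma(\varphi)-\sigma(m_\gamma(\varphi)),\,\gamma(m_\gamma(\varphi))-\gamma(\varphi)\rangle}{\langle\dot\gamma(m_\gamma(\varphi)),\,\gamma(m_\gamma(\varphi))-\gamma(\varphi)\rangle},$$ where both denominators are nonzero. -/

import Mathlib

open Set Filter Topology

noncomputable section

namespace CircInv

/-- The circle `S¹ = ℝ / 2πℤ`. -/
abbrev S1 : Type := AddCircle (2 * Real.pi)

/-- The Euclidean plane. -/
abbrev Plane : Type := EuclideanSpace ℝ (Fin 2)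

instance factTwoPi : Fact ((0 : ℝ) < 2 * Real.pi) := ⟨Real.two_pi_pos⟩

section FunctionSpace

variable (n : ℕ) (E : Type*) [NormedAddCommGroup E] [NormedSpace ℝ E]

/-- The functions `f : S¹ → E` that are `n` times continuously differentiable in the angle. -/
def ckSubmodule : Submodule ℝ (S1 → E) where
  carrier := {f | ContDiff ℝ n (fun x : ℝ => f (x : S1))}
  add_mem' := by
    intro f g hf hg
    rw [mem_ofPred_eq] at hf hg ⊢
    exact hf.add hg
  zero_mem' := by
    rw [mem_ofPred_eq]
    exact contDiff_const
  smul_mem' := by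
    intro c f hf
    rw [mem_ofPred_eq] at hf ⊢
    exact contDiff_const.smul hf

/-- The space `Cⁿ(S¹; E)`; its norm is defined below. -/
def Ck : Type _ := ↥(ckSubmodule n E)

instance : AddCommGroup (Ck n E) := inferInstanceAs (AddCommGroup ↥(ckSubmodule n E))

instance : Module ℝ (Ck n E) := inferInstanceAs (Module ℝ ↥(ckSubmodule n E))

instance : CoeFun (Ck n E) (fun _ => S1 → E) := ⟨fun f => f.1⟩

variable {n E}

theorem Ck.contDiff (f : Ck n E) : ContDiff ℝ n (fun x : ℝ => f (x : S1)) := f.2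

theorem periodic_iteratedDeriv (f : S1 → E) (i : ℕ) :
    Function.Periodic (iteratedDeriv i (fun x : ℝ => f (x : S1))) (2 * Real.pi) := by
  intro x
  have h : (fun z : ℝ => f ((z + 2 * Real.pi : ℝ) : S1)) = fun z : ℝ => f (z : S1) := by
    funext z
    rw [AddCircle.coe_add_period]
  have h2 := congrFun (iteratedDeriv_comp_add_const i (fun z : ℝ => f (z : S1)) (2 * Real.pi)) x
  rw [h] at h2
  exact h2.symm

/-- The `i`-th derivative of `f : S¹ → E` with respect to the angle, as a function on `S¹`. -/
def angDeriv (i : ℕ) (f : S1 → E) : S1 → E := (periodic_iteratedDeriv f i).lift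

theorem angDeriv_coe (i : ℕ) (f : S1 → E) (x : ℝ) :
    angDeriv i f (x : S1) = iteratedDeriv i (fun y : ℝ => f (y : S1)) x :=
  Function.Periodic.lift_coe _ x

theorem continuous_angDeriv (f : Ck n E) {i : ℕ} (hi : i ≤ n) : Continuous (angDeriv i f) := by
  have h : Continuous (iteratedDeriv i (fun x : ℝ => f (x : S1))) :=
    ContDiff.continuous_iteratedDeriv i f.contDiff (by exact_mod_cast hi)
  exact continuous_coinduced_dom.mpr (h.congr fun x => (angDeriv_coe i f x).symm)

variable (n E)

/-- The tuple `(f, f', …, f⁽ⁿ⁾)` of continuous functions on the circle. -/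
def jet : Ck n E →ₗ[ℝ] (Fin (n + 1) → C(S1, E)) where
  toFun f := fun i => ⟨angDeriv i f, continuous_angDeriv f (Nat.lt_succ_iff.mp i.2)⟩
  map_add' f g := by
    funext i
    ext φ
    induction φ using QuotientAddGroup.induction_on with
    | H x =>
      have hi : (i : ℕ) ≤ n := Nat.lt_succ_iff.mp i.2
      have hf : ContDiffAt ℝ (i : ℕ) (fun x : ℝ => f (x : S1)) x :=
        (f.contDiff.of_le (by exact_mod_cast hi)).contDiffAt
      have hg : ContDiffAt ℝ (i : ℕ) (fun x : ℝ => g (x : S1)) x :=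
        (g.contDiff.of_le (by exact_mod_cast hi)).contDiffAt
      change angDeriv i (f + g) (x : S1) = angDeriv i f (x : S1) + angDeriv i g (x : S1)
      rw [angDeriv_coe, angDeriv_coe, angDeriv_coe]
      exact iteratedDeriv_fun_add hf hg
  map_smul' c f := by
    funext i
    ext φ
    induction φ using QuotientAddGroup.induction_on with
    | H x =>
      have hi : (i : ℕ) ≤ n := Nat.lt_succ_iff.mp i.2
      have hf : ContDiffAt ℝ (i : ℕ) (fun x : ℝ => f (x : S1)) x :=
        (f.contDiff.of_le (by exact_mod_cast hi)).contDiffAt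
      change angDeriv i (c • f) (x : S1) = c • angDeriv i f (x : S1)
      rw [angDeriv_coe, angDeriv_coe]
      exact iteratedDeriv_fun_const_smul hf c

theorem jet_injective : Function.Injective (jet n E) := by
  intro f g h
  apply Subtype.ext
  funext φ
  induction φ using QuotientAddGroup.induction_on with
  | H x =>
    have h1 : angDeriv 0 f (x : S1) = angDeriv 0 g (x : S1) :=
      DFunLike.congr_fun (congrFun h 0) (x : S1)
    rw [angDeriv_coe, angDeriv_coe, iteratedDeriv_zero, iteratedDeriv_zero] at h1
    exact h1

/-- The `Cⁿ` norm `‖f‖ = max_{i ≤ n} sup_φ ‖f⁽ⁱ⁾(φ)‖`. -/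
instance : NormedAddCommGroup (Ck n E) :=
  NormedAddCommGroup.induced (Ck n E) (Fin (n + 1) → C(S1, E)) (jet n E) (jet_injective n E)

instance : NormedSpace ℝ (Ck n E) :=
  NormedSpace.induced ℝ (Ck n E) (Fin (n + 1) → C(S1, E)) (jet n E)

variable {n E}

theorem Ck.norm_le_iff (f : Ck n E) {C : ℝ} (hC : 0 ≤ C) :
    ‖f‖ ≤ C ↔ ∀ i ≤ n, ∀ φ : S1, ‖angDeriv i f φ‖ ≤ C := by
  change ‖jet n E f‖ ≤ C ↔ _
  rw [pi_norm_le_iff_of_nonneg hC]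
  constructor
  · intro h i hi φ
    exact (ContinuousMap.norm_le _ hC).mp (h ⟨i, Nat.lt_succ_iff.mpr hi⟩) φ
  · intro h i
    exact (ContinuousMap.norm_le _ hC).mpr (h i (Nat.lt_succ_iff.mp i.2))

end FunctionSpace

/-- The circle of radius `R` about the origin with constant speed parameterization,
`φ ↦ (R cos φ, R sin φ)`. -/
def circleFun (R : ℝ) : S1 → Plane :=
  Function.Periodic.lift (f := fun x : ℝ => (!₂[R * Real.cos x, R * Real.sin x] : Plane))
    (c := 2 * Real.pi) (fun x => by simp [Real.cos_add_two_pi, Real.sin_add_two_pi])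

theorem circleFun_contDiff (R : ℝ) (n : ℕ) :
    ContDiff ℝ n (fun x : ℝ => circleFun R (x : S1)) := by
  have h : (fun x : ℝ => circleFun R (x : S1)) =
      fun x : ℝ => (!₂[R * Real.cos x, R * Real.sin x] : Plane) := by
    funext x
    exact Function.Periodic.lift_coe _ x
  rw [h, contDiff_euclidean]
  intro i
  fin_cases i
  · exact contDiff_const.mul Real.contDiff_cos
  · exact contDiff_const.mul Real.contDiff_sin

/-- The circle of radius `R` as an element of `Cⁿ(S¹; ℝ²)`. -/
def circleCurve (n : ℕ) (R : ℝ) : Ck n Plane := ⟨circleFun R, circleFun_contDiff R n⟩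

/-- A map `S¹ → S¹` is of class `Cᵏ` if it has a lift `ℝ → ℝ` of class `Cᵏ`. -/
def IsCkMap (k : ℕ) (g : S1 → S1) : Prop :=
  ∃ G : ℝ → ℝ, ContDiff ℝ k G ∧ ∀ x : ℝ, g (x : S1) = (G x : S1)

/-- `Diffᵏ(S¹)`: bijections of the circle that are of class `Cᵏ` together with their inverse
(homeomorphisms for `k = 0`). -/
structure Diff (k : ℕ) where
  toEquiv : S1 ≃ S1
  isCk : IsCkMap k toEquiv
  isCk_symm : IsCkMap k toEquiv.symm

instance (k : ℕ) : CoeFun (Diff k) (fun _ => S1 → S1) := ⟨fun g => g.toEquiv⟩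

section Differentiability

variable {X : Type*} [NormedAddCommGroup X] [NormedSpace ℝ X] {k : ℕ}

/-- `Diffᵏ(S¹)` is viewed inside the Banach manifold `Cᵏ(S¹, S¹)`, modelled on `Cᵏ(S¹; ℝ)`. The
inverse of the chart centred at `g` is `u ↦ (φ ↦ g φ + u φ mod 2π)`, for small `u`.
`IsLocalRep P x₀ U` says that `U` is, near `x₀`, the map `P` read in the chart centred at `P x₀`. -/
def IsLocalRep (P : X → Diff k) (x₀ : X) (U : X → Ck k ℝ) : Prop :=
  U x₀ = 0 ∧ ∀ᶠ x in 𝓝 x₀, ∀ φ : S1, P x φ = P x₀ φ + ((U x φ : ℝ) : S1)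

/-- `P` is `ℓ` times continuously Fréchet differentiable near `x₀`. -/
def DiffContDiffAt (ℓ : ℕ) (P : X → Diff k) (x₀ : X) : Prop :=
  ∃ U : X → Ck k ℝ, IsLocalRep P x₀ U ∧ ContDiffAt ℝ ℓ U x₀

/-- `P` has the Fréchet derivative `P'` at `x₀`, where tangent vectors to `Diffᵏ(S¹)` are
identified with elements of `Cᵏ(S¹; ℝ)` through the charts above. -/
def DiffHasFDerivAt (P : X → Diff k) (P' : X →L[ℝ] Ck k ℝ) (x₀ : X) : Prop :=
  ∃ U : X → Ck k ℝ, IsLocalRep P x₀ U ∧ HasFDerivAt U P' x₀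

end Differentiability

/-- `ψ` is the next parameter after `φ`, in the positive direction, at which the curve `γ` meets
the circle of radius `r` about `γ φ`. -/
def IsNextParam (γ : S1 → Plane) (r : ℝ) (φ ψ : S1) : Prop :=
  ∃ t ∈ Ioo 0 (2 * Real.pi), ψ = φ + ((t : ℝ) : S1) ∧ dist (γ ψ) (γ φ) = r ∧
    ∀ s ∈ Ioo 0 t, dist (γ (φ + ((s : ℝ) : S1))) (γ φ) ≠ r

/-- `ψ` is the previous parameter before `φ`, at which the curve `γ` meets
the circle of radius `r` about `γ φ`. -/
def IsPrevParam (γ : S1 → Plane) (r : ℝ) (φ ψ : S1) : Prop :=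
  ∃ t ∈ Ioo 0 (2 * Real.pi), ψ = φ - ((t : ℝ) : S1) ∧ dist (γ ψ) (γ φ) = r ∧
    ∀ s ∈ Ioo 0 t, dist (γ (φ - ((s : ℝ) : S1))) (γ φ) ≠ r

end CircInv

end

noncomputable section

namespace CircInv

/-! ### The Banach spaces `Ck n E` and their basic operators. -/

section Spaces

variable {k m n : ℕ} {E F G : Type*} [NormedAddCommGroup E] [NormedSpace ℝ E]
  [NormedAddCommGroup F] [NormedSpace ℝ F] [NormedAddCommGroup G] [NormedSpace ℝ G]

/-! Write an intersection parameter as `φ + τ φ` with `τ` in `Cᵏ`. The pair `(γ, τ)` solves the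
equation `|γ (φ + τ φ) - γ φ|² = r²` in `Cᵏ`. On the round circle the left side is `2R²(1 - cos τ)`,
so there are two constant solutions `±α`, and the partial derivative in `τ` is multiplication by the
nonzero constant `±2R² sin α`. The implicit function theorem (`exists_intersection_param`) continues
both solutions to nearby `γ`, as `A γ` and `B γ`.

The analytic core is `contDiff_shift`: the operator `σ ↦ σ ∘ (id + τ)` in `L(Cⁿ, Cᵏ)` depends `ℓ`
times continuously differentiably on `τ` if `n ≥ k + ℓ + 1`. Each derivative in `τ` costs one
derivative of `σ`, and one more gives continuity in operator norm.

That no other parameters exist is a `C¹` perturbation argument (`isIntersectionPair_of_close`): the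
squared chord stays away from `r²` unless the offset is near `±α`, and it is strictly monotone
there. Bijectivity is then free: since the distance is symmetric, stepping forward and then backward
returns to the start, so `p γ` and `m γ` are mutually inverse, and both are of class `Cᵏ`. The
derivative formula is implicit differentiation along `γ + s • σ`. -/

theorem Ck.ext_real {f g : Ck n E} (h : ∀ x : ℝ, f (x : S1) = g (x : S1)) : f = g := by
  apply Subtype.ext
  funext φ
  induction φ using QuotientAddGroup.induction_on with
  | H x => exact h x

/-- An element of `Cⁿ(S¹; E)` given by a function of the angle. -/
def Ck.ofFun (f : S1 → E) (hf : ContDiff ℝ n fun x : ℝ => f (x : S1)) : Ck n E := ⟨f, hf⟩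

theorem Ck.add_apply (f g : Ck n E) (φ : S1) : (f + g) φ = f φ + g φ := rfl

theorem Ck.sub_apply (f g : Ck n E) (φ : S1) : (f - g) φ = f φ - g φ := rfl

theorem Ck.norm_iteratedDeriv_le (f : Ck n E) {i : ℕ} (hi : i ≤ n) (x : ℝ) :
    ‖iteratedDeriv i (fun y : ℝ => f (y : S1)) x‖ ≤ ‖f‖ := by
  rw [← angDeriv_coe]
  exact (f.norm_le_iff (norm_nonneg f)).mp le_rfl i hi x

theorem Ck.norm_le_of_iteratedDeriv (f : Ck n E) {C : ℝ} (hC : 0 ≤ C)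
    (h : ∀ i ≤ n, ∀ x : ℝ, ‖iteratedDeriv i (fun y : ℝ => f (y : S1)) x‖ ≤ C) : ‖f‖ ≤ C := by
  rw [f.norm_le_iff hC]
  intro i hi φ
  induction φ using QuotientAddGroup.induction_on with
  | H x => exact (angDeriv_coe i f x).symm ▸ h i hi x

theorem Ck.norm_apply_le (f : Ck n E) (φ : S1) : ‖f φ‖ ≤ ‖f‖ := by
  induction φ using QuotientAddGroup.induction_on with
  | H x => simpa using f.norm_iteratedDeriv_le (Nat.zero_le n) x

theorem Ck.norm_zero_le (f : Ck 0 E) {C : ℝ} (hC : 0 ≤ C) (h : ∀ x : ℝ, ‖f (x : S1)‖ ≤ C) :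
    ‖f‖ ≤ C := by
  refine f.norm_le_of_iteratedDeriv hC fun i hi x => ?_
  obtain rfl : i = 0 := by omega
  simpa using h x

/-- Evaluation at a point of the circle. -/
def Ck.eval (n : ℕ) (E : Type*) [NormedAddCommGroup E] [NormedSpace ℝ E] (φ : S1) :
    Ck n E →L[ℝ] E :=
  LinearMap.mkContinuous ⟨⟨fun f => f φ, fun _ _ => rfl⟩, fun _ _ => rfl⟩ 1
    fun f => (f.norm_apply_le φ).trans_eq (one_mul _).symm

/-- The inclusion `Cⁿ ⊆ Cᵐ` for `m ≤ n`. -/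
def Ck.incl (h : m ≤ n) : Ck n E →L[ℝ] Ck m E :=
  LinearMap.mkContinuous
    ⟨⟨fun f => Ck.ofFun f (f.contDiff.of_le (by exact_mod_cast h)), fun _ _ => rfl⟩, fun _ _ => rfl⟩ 1
    fun f => by
      rw [one_mul]
      exact Ck.norm_le_of_iteratedDeriv _ (norm_nonneg f)
        fun i hi x => f.norm_iteratedDeriv_le (hi.trans h) x

theorem angDeriv_one_coe (f : S1 → E) :
    (fun x : ℝ => angDeriv 1 f (x : S1)) = deriv fun x : ℝ => f (x : S1) := by
  funext x
  rw [angDeriv_coe, iteratedDeriv_one]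

theorem Ck.differentiable (f : Ck (n + 1) E) : Differentiable ℝ fun x : ℝ => f (x : S1) :=
  f.contDiff.differentiable (by simp)

theorem Ck.hasDerivAt (f : Ck (n + 1) E) (x : ℝ) :
    HasDerivAt (fun y : ℝ => f (y : S1)) (angDeriv 1 f (x : S1)) x := by
  rw [congrFun (angDeriv_one_coe f) x]
  exact (f.differentiable x).hasDerivAt

/-- Differentiation with respect to the angle, as a map `Cⁿ⁺¹ → Cⁿ`. -/
def Ck.D : Ck (n + 1) E →L[ℝ] Ck n E :=
  LinearMap.mkContinuous
    ⟨⟨fun f => ⟨angDeriv 1 f, by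
        change ContDiff ℝ n _
        rw [angDeriv_one_coe]
        have := f.contDiff
        push_cast at this
        exact (contDiff_succ_iff_deriv.mp this).2.2⟩,
      fun f g => Ck.ext_real fun x => ((f + g).hasDerivAt x).unique
        ((f.hasDerivAt x).add (g.hasDerivAt x))⟩,
      fun c f => Ck.ext_real fun x => ((c • f).hasDerivAt x).unique
        ((f.hasDerivAt x).const_smul c)⟩ 1
    fun f => by
      rw [one_mul]
      refine Ck.norm_le_of_iteratedDeriv _ (norm_nonneg f) fun i hi x => ?_
      change ‖iteratedDeriv i (fun x : ℝ => angDeriv 1 f (x : S1)) x‖ ≤ _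
      rw [angDeriv_one_coe, ← iteratedDeriv_succ']
      exact f.norm_iteratedDeriv_le (by omega) x

theorem Ck.D_apply (f : Ck (n + 1) E) (φ : S1) : Ck.D f φ = angDeriv 1 f φ := rfl

theorem Ck.norm_D_le (f : Ck (n + 1) E) : ‖Ck.D f‖ ≤ ‖f‖ := by
  simpa using Ck.D.le_of_opNorm_le (LinearMap.mkContinuous_norm_le _ zero_le_one _) f

/-- The isometric embedding `f ↦ (f, f')` of `Cⁿ⁺¹` into `C⁰ × Cⁿ`. -/
def Ck.splitDeriv : Ck (n + 1) E →ₗᵢ[ℝ] Ck 0 E × Ck n E where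
  toLinearMap := ((Ck.incl (Nat.zero_le _)).prod Ck.D : Ck (n + 1) E →L[ℝ] Ck 0 E × Ck n E)
  norm_map' f := by
    change max ‖Ck.incl (Nat.zero_le _) f‖ ‖Ck.D f‖ = ‖f‖
    apply le_antisymm
    · refine max_le ?_ ?_
      · exact Ck.norm_zero_le _ (norm_nonneg f) fun x => f.norm_apply_le x
      · exact f.norm_D_le
    · refine f.norm_le_of_iteratedDeriv (le_max_of_le_left (norm_nonneg _)) fun i hi x => ?_
      cases i with
      | zero =>
        rw [iteratedDeriv_zero]
        exact le_max_of_le_left ((Ck.incl (Nat.zero_le _) f).norm_apply_le x)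
      | succ i =>
        rw [iteratedDeriv_succ', ← angDeriv_one_coe]
        exact le_max_of_le_right ((Ck.D f).norm_iteratedDeriv_le (by omega) x)

/-- The pointwise application of a continuous bilinear map. -/
def Ck.bilin (n : ℕ) (B : E →L[ℝ] F →L[ℝ] G) : Ck n E →L[ℝ] Ck n F →L[ℝ] Ck n G :=
  LinearMap.mkContinuous₂
    (LinearMap.mk₂ ℝ
      (fun f g => (⟨fun φ => B (f φ) (g φ), (B.contDiff.comp f.contDiff).clm_apply g.contDiff⟩ :
        Ck n G))
      (fun f f' g => Ck.ext_real fun x => by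
        change B (f x + f' x) (g x) = B (f x) (g x) + B (f' x) (g x); simp)
      (fun c f g => Ck.ext_real fun x => by
        change B (c • f x) (g x) = c • B (f x) (g x); simp)
      (fun f g g' => Ck.ext_real fun x => by
        change B (f x) (g x + g' x) = B (f x) (g x) + B (f x) (g' x); simp)
      (fun c f g => Ck.ext_real fun x => by
        change B (f x) (c • g x) = c • B (f x) (g x); simp))
    -- Leibniz rule: the binomial coefficients of order `i ≤ n` sum to `2 ^ i`.
    (‖B‖ * 2 ^ n) fun f g => by
      refine Ck.norm_le_of_iteratedDeriv _ (by positivity) fun i hi x => ?_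
      change ‖iteratedDeriv i (fun y : ℝ => B (f (y : S1)) (g (y : S1))) x‖ ≤ _
      rw [← norm_iteratedFDeriv_eq_norm_iteratedDeriv]
      refine (B.norm_iteratedFDeriv_le_of_bilinear f.contDiff g.contDiff x
        (by exact_mod_cast hi)).trans ?_
      calc _ ≤ ‖B‖ * ∑ j ∈ Finset.range (i + 1), (i.choose j : ℝ) * ‖f‖ * ‖g‖ := by
            gcongr with j hj
            · rw [norm_iteratedFDeriv_eq_norm_iteratedDeriv]
              exact f.norm_iteratedDeriv_le (by have := Finset.mem_range.mp hj; omega) x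
            · rw [norm_iteratedFDeriv_eq_norm_iteratedDeriv]
              exact g.norm_iteratedDeriv_le (by omega) x
        _ = ‖B‖ * 2 ^ i * ‖f‖ * ‖g‖ := by
            rw [← Finset.sum_mul, ← Finset.sum_mul]
            have := Nat.sum_range_choose i
            have h2 : ∑ j ∈ Finset.range (i + 1), (i.choose j : ℝ) = 2 ^ i := by exact_mod_cast this
            rw [h2]; ring
        _ ≤ ‖B‖ * 2 ^ n * ‖f‖ * ‖g‖ := by
            gcongr
            norm_num

/-- Pointwise multiplication by a scalar function. -/
def Ck.mul (n : ℕ) (E : Type*) [NormedAddCommGroup E] [NormedSpace ℝ E] :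
    Ck n ℝ →L[ℝ] Ck n E →L[ℝ] Ck n E := Ck.bilin n (ContinuousLinearMap.lsmul ℝ ℝ)

/-- Constant functions. -/
def Ck.const (n : ℕ) (c : E) : Ck n E := Ck.ofFun (fun _ => c) contDiff_const

/-- The power `i` only matches the hypothesis of `norm_iteratedFDeriv_comp_le`; the first power
already bounds the left side. Order zero is excluded because the identity is unbounded. -/
theorem norm_iteratedDeriv_id_add_le (τ : Ck k ℝ) {i : ℕ} (hi1 : 1 ≤ i) (hi : i ≤ k) (x : ℝ) :
    ‖iteratedDeriv i (fun y : ℝ => y + τ (y : S1)) x‖ ≤ (1 + ‖τ‖) ^ i := by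
  have hτ : ContDiffAt ℝ i (fun y : ℝ => τ (y : S1)) x :=
    (τ.contDiff.of_le (by exact_mod_cast hi)).contDiffAt
  have hid : ContDiffAt ℝ i (fun y : ℝ => y) x := contDiffAt_id
  rw [iteratedDeriv_fun_add hid hτ]
  have h1 : ‖iteratedDeriv i (fun y : ℝ => y) x‖ ≤ 1 := by
    obtain ⟨j, rfl⟩ : ∃ j, i = j + 1 := ⟨i - 1, by omega⟩
    rw [iteratedDeriv_succ']
    have : deriv (fun y : ℝ => y) = fun _ => (1 : ℝ) := by funext y; simp
    rw [this, iteratedDeriv_const]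
    split_ifs <;> simp
  calc _ ≤ 1 + ‖τ‖ := (norm_add_le _ _).trans (add_le_add h1 (τ.norm_iteratedDeriv_le hi x))
    _ ≤ (1 + ‖τ‖) ^ i := le_self_pow₀ (by linarith [norm_nonneg τ]) (by omega)

/-- The composition operator `σ ↦ σ ∘ (id + τ)` from `Cⁿ` to `Cᵏ`, for `τ` of class `Cᵏ`. -/
def shift (h : k ≤ n) (E : Type*) [NormedAddCommGroup E] [NormedSpace ℝ E] (τ : Ck k ℝ) :
    Ck n E →L[ℝ] Ck k E :=
  LinearMap.mkContinuous
    ⟨⟨fun σ => ⟨fun φ => σ (φ + ((τ φ : ℝ) : S1)),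
        (σ.contDiff.of_le (by exact_mod_cast h)).comp (contDiff_id.add τ.contDiff)⟩,
      fun _ _ => rfl⟩, fun _ _ => rfl⟩ (k.factorial * (1 + ‖τ‖) ^ k)
    fun σ => by
      refine Ck.norm_le_of_iteratedDeriv _ (by positivity) fun i hi x => ?_
      change ‖iteratedDeriv i ((fun y : ℝ => σ (y : S1)) ∘ (fun y : ℝ => y + τ (y : S1))) x‖ ≤ _
      rw [← norm_iteratedFDeriv_eq_norm_iteratedDeriv]
      have h1 : (1 : ℝ) ≤ 1 + ‖τ‖ := by linarith [norm_nonneg τ]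
      calc _ ≤ i.factorial * ‖σ‖ * (1 + ‖τ‖) ^ i := by
            refine norm_iteratedFDeriv_comp_le (N := k) (σ.contDiff.of_le (by exact_mod_cast h))
              (contDiff_id.add τ.contDiff) (by exact_mod_cast hi) x (fun j hj => ?_)
              fun j hj1 hj => ?_
            · rw [norm_iteratedFDeriv_eq_norm_iteratedDeriv]
              exact σ.norm_iteratedDeriv_le (by omega) _
            · rw [norm_iteratedFDeriv_eq_norm_iteratedDeriv]
              exact norm_iteratedDeriv_id_add_le τ hj1 (hj.trans hi) x
        _ ≤ k.factorial * ‖σ‖ * (1 + ‖τ‖) ^ k := by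
            gcongr
        _ = _ := by ring

/-- Chain rule. It expresses the derivative of a shift through a shift of one order less, which
drives the induction on `k` in `contDiff_shift`. -/
theorem D_shift (h : k ≤ n) (τ : Ck (k + 1) ℝ) (σ : Ck (n + 1) E) :
    Ck.D (shift (Nat.succ_le_succ h) E τ σ) =
      Ck.mul k E (Ck.const k 1 + Ck.D τ) (shift h E (Ck.incl (Nat.le_succ k) τ) (Ck.D σ)) := by
  refine Ck.ext_real fun x => ?_
  refine ((shift (Nat.succ_le_succ h) E τ σ).hasDerivAt x).unique ?_
  have h1 : HasDerivAt (fun y : ℝ => y + τ (y : S1)) (1 + angDeriv 1 τ (x : S1)) x :=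
    (hasDerivAt_id x).add (τ.hasDerivAt x)
  exact (σ.hasDerivAt (x + τ x)).scomp x h1

/-- The jets of a Cauchy sequence converge uniformly, and uniform convergence of derivatives makes
each component of the limit the derivative of the preceding one. Completeness serves both the
implicit function theorem and the closed-range argument below. -/
instance Ck.completeSpace [CompleteSpace E] : CompleteSpace (Ck n E) := by
  refine Metric.complete_of_cauchySeq_tendsto fun u hu => ?_
  have hiso : Isometry (jet n E) := AddMonoidHomClass.isometry_of_norm (jet n E) fun _ => rfl
  obtain ⟨h, hh⟩ := cauchySeq_tendsto_of_complete (hiso.uniformContinuous.comp_cauchySeq hu)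
  have hunif (i : Fin (n + 1)) :
      TendstoUniformly (fun (j : ℕ) (x : ℝ) => iteratedDeriv i (fun y : ℝ => u j (y : S1)) x)
        (fun x : ℝ => h i (x : S1)) atTop := by
    have h1 := ContinuousMap.tendsto_iff_tendstoUniformly.mp ((tendsto_pi_nhds.mp hh) i)
    have h2 := h1.comp (fun x : ℝ => (x : S1))
    have h3 : (fun (j : ℕ) (x : ℝ) => iteratedDeriv i (fun y : ℝ => u j (y : S1)) x) =
        fun (j : ℕ) (x : ℝ) => angDeriv i (u j) (x : S1) := by
      funext j x
      exact (angDeriv_coe i (u j) x).symm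
    rw [h3]
    exact h2
  have hderiv (i : ℕ) (hi : i < n) (x : ℝ) :
      HasDerivAt (fun y : ℝ => h ⟨i, by omega⟩ (y : S1)) (h ⟨i + 1, by omega⟩ (x : S1)) x := by
    refine hasDerivAt_of_tendstoUniformly (hunif ⟨i + 1, by omega⟩)
      (Eventually.of_forall fun j y => ?_)
      (fun y => (hunif ⟨i, by omega⟩).tendsto_at y) x
    have hd : DifferentiableAt ℝ (iteratedDeriv i (fun y : ℝ => u j (y : S1))) y :=
      (u j).contDiff.differentiable_iteratedDeriv i (by exact_mod_cast hi) y
    have := hd.hasDerivAt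
    rwa [← congrFun iteratedDeriv_succ y] at this
  have hiter (i : ℕ) (hi : i ≤ n) :
      iteratedDeriv i (fun x : ℝ => h 0 (x : S1)) = fun x : ℝ => h ⟨i, by omega⟩ (x : S1) := by
    induction i with
    | zero => rw [iteratedDeriv_zero]; rfl
    | succ i ih =>
      rw [iteratedDeriv_succ, ih (by omega)]
      funext x
      exact (hderiv i (by omega) x).deriv
  have hC : ContDiff ℝ n (fun x : ℝ => h 0 (x : S1)) := by
    have h0 : ContDiff ℝ ((n : ℕ∞) : WithTop ℕ∞) (fun x : ℝ => h 0 (x : S1)) := by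
      refine contDiff_iff_iteratedDeriv.mpr ⟨fun i hi => ?_, fun i hi => ?_⟩
      · rw [hiter i (by exact_mod_cast hi)]
        exact (h _).continuous.comp (AddCircle.continuous_mk' _)
      · have hi' : i < n := by exact_mod_cast hi
        rw [hiter i hi'.le]
        exact fun x => (hderiv i hi' x).differentiableAt
    exact h0
  refine ⟨Ck.ofFun (h 0) hC, ?_⟩
  refine hiso.isEmbedding.tendsto_nhds_iff.mpr ?_
  convert hh using 2
  funext i
  ext φ
  induction φ using QuotientAddGroup.induction_on with
  | H x => exact (angDeriv_coe _ _ x).trans (congrFun (hiter i (by omega)) x)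

end Spaces

-- Differentiability tested through a linear isometric embedding.

universe u

/-- The values of `L` are limits of difference quotients in the range of `J`, which is closed
because `Y` is complete; so `L` factors through `J`, and the isometry transfers the remainder
estimate. -/
theorem exists_hasFDerivAt_of_linearIsometry_comp {X Y Z : Type*} [NormedAddCommGroup X] [NormedSpace ℝ X]
    [NormedAddCommGroup Y] [NormedSpace ℝ Y] [NormedAddCommGroup Z] [NormedSpace ℝ Z]
    [CompleteSpace Y] (J : Y →ₗᵢ[ℝ] Z) {f : X → Y} {L : X →L[ℝ] Z} {x : X}
    (h : HasFDerivAt (fun y => J (f y)) L x) : ∃ K : X →L[ℝ] Y, HasFDerivAt f K x ∧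
      J.toContinuousLinearMap.comp K = L := by
  have hclosed : IsClosed (LinearMap.range J.toLinearMap : Set Z) := by
    have := J.isometry.isClosedEmbedding.isClosed_range
    exact this
  have hmem (v : X) : L v ∈ LinearMap.range J.toLinearMap := by
    have hline : HasDerivAt (fun t : ℝ => J (f (x + t • v))) (L v) 0 := by
      have h0 : HasFDerivAt (fun y => J (f y)) L (x + (0 : ℝ) • v) := by simpa using h
      have h1 : HasDerivAt (fun t : ℝ => x + t • v) v 0 := by
        simpa using ((hasDerivAt_id (0 : ℝ)).smul_const v).const_add x
      exact h0.comp_hasDerivAt 0 h1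
    have hlim := hline.tendsto_slope_zero
    refine hclosed.mem_of_tendsto hlim (Eventually.of_forall fun t => ?_)
    exact Submodule.smul_mem _ _ (Submodule.sub_mem _ ⟨_, rfl⟩ ⟨_, rfl⟩)
  let e := J.equivRange
  let K : X →L[ℝ] Y := (e.symm.toContinuousLinearEquiv : _ →L[ℝ] Y).comp
    (L.codRestrict (LinearMap.range J.toLinearMap) hmem)
  have hK : J.toContinuousLinearMap.comp K = L := by
    ext v
    have : e (e.symm ⟨L v, hmem v⟩) = ⟨L v, hmem v⟩ := e.apply_symm_apply _
    exact congrArg Subtype.val this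
  refine ⟨K, ?_, hK⟩
  rw [hasFDerivAt_iff_isLittleO] at h ⊢
  refine (Asymptotics.isLittleO_norm_left.mp ?_)
  refine (Asymptotics.isLittleO_norm_left.mpr h).congr_left fun y => ?_
  rw [← hK]
  change ‖J (f y) - J (f x) - J (K (y - x))‖ = _
  rw [← map_sub, ← map_sub, J.norm_map]

/-- A map is of class `Cⁿ` if its composition with a linear isometric embedding is. -/
theorem contDiff_of_linearIsometry_comp {X Y Z : Type u} [NormedAddCommGroup X] [NormedSpace ℝ X]
    [NormedAddCommGroup Y] [NormedSpace ℝ Y] [NormedAddCommGroup Z] [NormedSpace ℝ Z]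
    [CompleteSpace Y] (J : Y →ₗᵢ[ℝ] Z) {f : X → Y} (n : ℕ)
    (h : ContDiff ℝ n (fun x => J (f x))) : ContDiff ℝ n f := by
  induction n generalizing Y Z with
  | zero =>
    rw [Nat.cast_zero, contDiff_zero] at h ⊢
    exact J.isometry.isEmbedding.continuous_iff.mpr h
  | succ n ih =>
    rw [Nat.cast_succ] at h ⊢
    obtain ⟨L, hL, hd⟩ := contDiff_succ_iff_hasFDerivAt.mp h
    choose K hK hJK using fun x => exists_hasFDerivAt_of_linearIsometry_comp J (hd x)
    refine contDiff_succ_iff_hasFDerivAt.mpr ⟨K, ?_, hK⟩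
    -- Postcomposition with `J` is again a linear isometry, so the induction hypothesis applies to
    -- the derivative. The target changes to `X →L[ℝ] Y`, hence the generalization over `Y` and `Z`
    -- and the common universe.
    let P : (X →L[ℝ] Y) →ₗᵢ[ℝ] (X →L[ℝ] Z) :=
      { toLinearMap := (ContinuousLinearMap.postcomp X J.toContinuousLinearMap).toLinearMap
        norm_map' := fun T => J.norm_toContinuousLinearMap_comp (g := T) }
    exact ih P ((funext hJK : (fun x => P (K x)) = L) ▸ hL)

/-! ### Smooth dependence of the composition operator on the shift. -/

section Shift

variable {k n : ℕ} {E : Type} [NormedAddCommGroup E] [NormedSpace ℝ E]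

theorem norm_sub_le_of_Ck (σ : Ck (n + 1) E) (x t : ℝ) :
    ‖σ ((x + t : ℝ) : S1) - σ (x : S1)‖ ≤ ‖σ‖ * |t| := by
  have := Convex.norm_image_sub_le_of_norm_hasDerivWithin_le (s := univ) (C := ‖σ‖) (x := x)
    (y := x + t) (fun y _ => (σ.hasDerivAt y).hasDerivWithinAt)
    (fun y _ => by
      rw [angDeriv_coe]
      exact σ.norm_iteratedDeriv_le (by omega) y) convex_univ (mem_univ _) (mem_univ _)
  simpa using this

/-- Mean value inequality for the remainder, whose derivative is an increment of `σ'`. Linearity of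
the bound in `‖σ‖` is what later turns it into an operator norm estimate. -/
theorem norm_taylor_le_of_Ck (σ : Ck (n + 2) E) (x t : ℝ) :
    ‖σ ((x + t : ℝ) : S1) - σ (x : S1) - t • angDeriv 1 σ (x : S1)‖ ≤ ‖σ‖ * |t| * |t| := by
  have hD : ‖Ck.D σ‖ ≤ ‖σ‖ := σ.norm_D_le
  have := Convex.norm_image_sub_le_of_norm_hasDerivWithin_le
    (f := fun s : ℝ => σ ((x + s : ℝ) : S1) - s • angDeriv 1 σ (x : S1))
    (f' := fun s : ℝ => angDeriv 1 σ ((x + s : ℝ) : S1) - angDeriv 1 σ (x : S1))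
    (s := uIcc 0 t) (C := ‖σ‖ * |t|) (x := 0) (y := t)
    (fun s _ => by
      have h1 : HasDerivAt (fun s : ℝ => x + s) 1 s := (hasDerivAt_id s).const_add x
      have h2 := (σ.hasDerivAt (x + s)).scomp s h1
      have h3 := (hasDerivAt_id s).smul_const (angDeriv 1 σ (x : S1))
      have h4 := h2.sub h3
      simp only [one_smul] at h4
      exact h4.hasDerivWithinAt)
    (fun s hs => by
      refine (norm_sub_le_of_Ck (Ck.D σ) x s).trans ?_
      have : |s| ≤ |t| := by
        simpa using abs_sub_left_of_mem_uIcc hs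
      gcongr) (convex_uIcc 0 t) left_mem_uIcc right_mem_uIcc
  simp only [add_zero, zero_smul, sub_zero, Real.norm_eq_abs] at this
  convert this using 2
  abel

/-- The linear map `T ↦ (η ↦ (σ ↦ η • T σ'))`. -/
def shiftDeriv (n : ℕ) (E : Type) [NormedAddCommGroup E] [NormedSpace ℝ E] :
    (Ck n E →L[ℝ] Ck 0 E) →L[ℝ] (Ck 0 ℝ →L[ℝ] Ck (n + 1) E →L[ℝ] Ck 0 E) :=
  (ContinuousLinearMap.precomp _ (Ck.mul 0 E)).comp
    ((ContinuousLinearMap.compL ℝ (Ck (n + 1) E) (Ck 0 E) (Ck 0 E)).flip.comp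
      (ContinuousLinearMap.precomp _ Ck.D))

/-- The derivative in direction `η` is `σ ↦ η • (σ' ∘ (id + τ))`, again a shift but acting on one
order less. The Taylor remainder is quadratic uniformly over the unit ball of `C²`-bounded `σ`,
hence the order `n + 2`. -/
theorem hasFDerivAt_shift_zero (n : ℕ) (τ : Ck 0 ℝ) :
    HasFDerivAt (shift (Nat.zero_le (n + 2)) E)
      (shiftDeriv (n + 1) E (shift (Nat.zero_le (n + 1)) E τ)) τ := by
  refine HasFDerivAt.of_isLittleO ?_
  have hO : (fun τ' => shift (Nat.zero_le (n + 2)) E τ' - shift (Nat.zero_le (n + 2)) E τ -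
      shiftDeriv (n + 1) E (shift (Nat.zero_le (n + 1)) E τ) (τ' - τ)) =O[𝓝 τ]
      fun τ' => ‖τ' - τ‖ * ‖τ' - τ‖ := by
    refine Asymptotics.IsBigO.of_bound 1 (Eventually.of_forall fun τ' => ?_)
    rw [one_mul, Real.norm_of_nonneg (by positivity)]
    refine ContinuousLinearMap.opNorm_le_bound _ (by positivity) fun σ => ?_
    refine Ck.norm_zero_le _ (by positivity) fun x => ?_
    have h1 := norm_taylor_le_of_Ck σ (x + τ x) ((τ' - τ) x)
    have h2 : |(τ' - τ) (x : S1)| ≤ ‖τ' - τ‖ := (τ' - τ).norm_apply_le x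
    have h3 : x + τ (x : S1) + (τ' - τ) (x : S1) = x + τ' (x : S1) := by
      rw [Ck.sub_apply]; ring
    rw [h3] at h1
    refine (le_trans h1 ?_)
    calc _ ≤ ‖σ‖ * ‖τ' - τ‖ * ‖τ' - τ‖ := by gcongr
      _ = _ := by ring
  refine hO.trans_isLittleO ?_
  have h1 : (fun τ' : Ck 0 ℝ => ‖τ' - τ‖) =o[𝓝 τ] fun _ => (1 : ℝ) := by
    rw [Asymptotics.isLittleO_one_iff]
    have : Continuous fun τ' : Ck 0 ℝ => ‖τ' - τ‖ := by fun_prop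
    simpa using this.tendsto τ
  have h2 := h1.mul_isBigO (Asymptotics.isBigO_refl (fun τ' : Ck 0 ℝ => ‖τ' - τ‖) (𝓝 τ))
  simpa using h2

theorem continuous_shift_zero (n : ℕ) : Continuous (shift (Nat.zero_le (n + 1)) E) := by
  have : LipschitzWith 1 (shift (Nat.zero_le (n + 1)) E) := by
    refine LipschitzWith.of_dist_le_mul fun τ' τ => ?_
    rw [NNReal.coe_one, one_mul, dist_eq_norm, dist_eq_norm]
    refine ContinuousLinearMap.opNorm_le_bound _ (by positivity) fun σ => ?_
    refine Ck.norm_zero_le _ (by positivity) fun x => ?_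
    have h1 := norm_sub_le_of_Ck σ (x + τ x) ((τ' - τ) x)
    have h2 : |(τ' - τ) (x : S1)| ≤ ‖τ' - τ‖ := (τ' - τ).norm_apply_le x
    have h3 : x + τ (x : S1) + (τ' - τ) (x : S1) = x + τ' (x : S1) := by
      rw [Ck.sub_apply]; ring
    rw [h3] at h1
    refine (le_trans h1 ?_)
    rw [mul_comm]
    gcongr
  exact this.continuous

theorem contDiff_shift_zero (ℓ n : ℕ) (h : ℓ + 1 ≤ n) :
    ContDiff ℝ ℓ (shift (Nat.zero_le n) E) := by
  induction ℓ generalizing n with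
  | zero =>
    obtain ⟨n, rfl⟩ : ∃ j, n = j + 1 := ⟨n - 1, by omega⟩
    rw [Nat.cast_zero, contDiff_zero]
    exact continuous_shift_zero n
  | succ ℓ ih =>
    obtain ⟨n, rfl⟩ : ∃ j, n = j + 2 := ⟨n - 2, by omega⟩
    rw [Nat.cast_succ, contDiff_succ_iff_hasFDerivAt]
    exact ⟨_, (shiftDeriv (n + 1) E).contDiff.comp (ih (n + 1) (by omega)),
      hasFDerivAt_shift_zero n⟩

/-- The composition operator depends `ℓ` times continuously differentiably on the shift. -/
theorem contDiff_shift [CompleteSpace E] (ℓ k n : ℕ) (hkn : k ≤ n) (h : k + ℓ + 1 ≤ n) :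
    ContDiff ℝ ℓ (shift hkn E) := by
  induction k generalizing n with
  | zero => exact contDiff_shift_zero ℓ n (by omega)
  | succ k ih =>
    obtain ⟨n, rfl⟩ : ∃ j, n = j + 1 := ⟨n - 1, by omega⟩
    have hkn' : k ≤ n := by omega
    -- By `f ↦ (f, f')` it suffices to treat the two components: the first is the case `k = 0`, and
    -- `D_shift` reduces the second to order `k`.
    let P : (Ck (n + 1) E →L[ℝ] Ck (k + 1) E) →ₗᵢ[ℝ] (Ck (n + 1) E →L[ℝ] Ck 0 E × Ck k E) :=
      { toLinearMap := (ContinuousLinearMap.postcomp _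
          (Ck.splitDeriv (n := k) (E := E)).toContinuousLinearMap).toLinearMap
        norm_map' := fun T => Ck.splitDeriv.norm_toContinuousLinearMap_comp (g := T) }
    refine contDiff_of_linearIsometry_comp P ℓ ?_
    have hP : (fun τ => P (shift hkn E τ)) = fun τ =>
        (ContinuousLinearMap.prodₗᵢ ℝ
          (shift (Nat.zero_le (n + 1)) E (Ck.incl (Nat.zero_le _) τ),
            (Ck.mul k E (Ck.const k 1 + Ck.D τ)).comp
              ((shift hkn' E (Ck.incl (Nat.le_succ k) τ)).comp Ck.D)) :
          Ck (n + 1) E →L[ℝ] Ck 0 E × Ck k E) := by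
      funext τ
      ext1 σ
      exact Prod.ext rfl (D_shift hkn' τ σ)
    rw [hP]
    refine (LinearIsometryEquiv.contDiff _).comp (ContDiff.prodMk ?_ ?_)
    · exact (contDiff_shift_zero ℓ (n + 1) (by omega)).comp (ContinuousLinearMap.contDiff _)
    · refine ContDiff.clm_comp ?_ (ContDiff.clm_comp ?_ contDiff_const)
      · exact (ContinuousLinearMap.contDiff _).comp
          (contDiff_const.add (ContinuousLinearMap.contDiff _))
      · exact (ih n hkn' (by omega)).comp (ContinuousLinearMap.contDiff _)

end Shift

/-! ### The chord equation, its implicit solutions and their derivatives. -/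

section Implicit

variable {k n : ℕ}

theorem circleCurve_coe (R x : ℝ) :
    circleCurve n R (x : S1) = !₂[R * Real.cos x, R * Real.sin x] := by
  change circleFun R (x : S1) = _
  exact Function.Periodic.lift_coe _ x

theorem angDeriv_circleCurve (R x : ℝ) :
    angDeriv 1 (circleCurve n R) (x : S1) = !₂[-(R * Real.sin x), R * Real.cos x] := by
  have h : HasDerivAt (fun y : ℝ => circleCurve n R (y : S1))
      !₂[-(R * Real.sin x), R * Real.cos x] x := by
    have h0 : (fun y : ℝ => circleCurve n R (y : S1)) =
        fun y : ℝ => (!₂[R * Real.cos y, R * Real.sin y] : Plane) := funext (circleCurve_coe R)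
    rw [h0]
    have h1 : HasDerivAt (fun y : ℝ => ![R * Real.cos y, R * Real.sin y])
        ![-(R * Real.sin x), R * Real.cos x] x := by
      rw [hasDerivAt_pi]
      intro i
      fin_cases i
      · simpa using (Real.hasDerivAt_cos x).const_mul R
      · simpa using (Real.hasDerivAt_sin x).const_mul R
    exact (PiLp.continuousLinearEquiv 2 ℝ fun _ : Fin 2 => ℝ).symm.hasFDerivAt.comp_hasDerivAt x h1
  rw [angDeriv_coe, iteratedDeriv_one]
  exact h.deriv

theorem norm_sq_circleCurve_sub (R x t : ℝ) :
    ‖circleCurve n R ((x + t : ℝ) : S1) - circleCurve n R (x : S1)‖ ^ 2 =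
      2 * R ^ 2 * (1 - Real.cos t) := by
  rw [circleCurve_coe, circleCurve_coe, EuclideanSpace.norm_sq_eq]
  simp only [Fin.sum_univ_two, PiLp.sub_apply, Real.norm_eq_abs, sq_abs]
  simp only [Matrix.cons_val_zero, Matrix.cons_val_one, Real.cos_add, Real.sin_add]
  have h1 := Real.sin_sq_add_cos_sq x
  have h2 := Real.sin_sq_add_cos_sq t
  linear_combination R ^ 2 * (1 + (Real.sin t ^ 2 + Real.cos t ^ 2) - 2 * Real.cos t) * h1 +
    R ^ 2 * h2

/-- This is half the `t`-derivative of the squared chord; its sign decides monotonicity. -/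
theorem inner_circleCurve (R x t : ℝ) :
    inner ℝ (angDeriv 1 (circleCurve n R) ((x + t : ℝ) : S1))
      (circleCurve n R ((x + t : ℝ) : S1) - circleCurve n R (x : S1)) = R ^ 2 * Real.sin t := by
  rw [circleCurve_coe, circleCurve_coe, angDeriv_circleCurve, PiLp.inner_apply]
  simp only [Fin.sum_univ_two, PiLp.sub_apply]
  simp only [Matrix.cons_val_zero, Matrix.cons_val_one, Real.cos_add, Real.sin_add,
    RCLike.inner_apply, conj_trivial]
  have h1 := Real.sin_sq_add_cos_sq x
  linear_combination R ^ 2 * Real.sin t * h1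

/-- The real inner product of the plane as a continuous bilinear map. -/
def planeInner : Plane →L[ℝ] Plane →L[ℝ] ℝ :=
  (isBoundedBilinearMap_inner (𝕜 := ℝ) (E := Plane)).toContinuousLinearMap

/-- The function `φ ↦ |γ (φ + τ φ) - γ φ|²`, as an element of `Cᵏ`. -/
def chordSq (h : k ≤ n) (q : Ck n Plane × Ck k ℝ) : Ck k ℝ :=
  Ck.bilin k planeInner (shift h Plane q.2 q.1 - Ck.incl h q.1)
    (shift h Plane q.2 q.1 - Ck.incl h q.1)

theorem chordSq_apply (h : k ≤ n) (q : Ck n Plane × Ck k ℝ) (φ : S1) :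
    chordSq h q φ = ‖q.1 (φ + ((q.2 φ : ℝ) : S1)) - q.1 φ‖ ^ 2 := by
  rw [← real_inner_self_eq_norm_sq]
  rfl

theorem contDiff_chordSq (ℓ : ℕ) (h : k ≤ n) (hn : k + ℓ + 1 ≤ n) :
    ContDiff ℝ ℓ (chordSq h) := by
  have h1 : ContDiff ℝ ℓ fun q : Ck n Plane × Ck k ℝ =>
      shift h Plane q.2 q.1 - Ck.incl h q.1 :=
    (((contDiff_shift ℓ k n h hn).comp contDiff_snd).clm_apply contDiff_fst).sub
      ((Ck.incl h).contDiff.comp contDiff_fst)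
  exact ((Ck.bilin k planeInner).contDiff.comp h1).clm_apply h1

theorem isInvertible_smul_id {X : Type*} [NormedAddCommGroup X] [NormedSpace ℝ X] {c : ℝ}
    (hc : c ≠ 0) : (c • ContinuousLinearMap.id ℝ X).IsInvertible := by
  refine ContinuousLinearMap.IsInvertible.of_inverse (g := c⁻¹ • ContinuousLinearMap.id ℝ X) ?_ ?_
  · ext x
    simp [smul_smul, hc]
  · ext x
    simp [smul_smul, hc]

/-- Since differentiability is given, the derivative can be read off pointwise along `β + s • η`,
where the chord of the circle is explicit. -/
theorem fderiv_chordSq_circleCurve (h : k ≤ n) (R β : ℝ)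
    (hd : DifferentiableAt ℝ (chordSq h) (circleCurve n R, Ck.const k β)) :
    (fderiv ℝ (chordSq h) (circleCurve n R, Ck.const k β)).comp
      (ContinuousLinearMap.inr ℝ (Ck n Plane) (Ck k ℝ)) =
      (2 * R ^ 2 * Real.sin β) • ContinuousLinearMap.id ℝ (Ck k ℝ) := by
  refine ContinuousLinearMap.ext fun η => Ck.ext_real fun x => ?_
  have hline : HasDerivAt (fun s : ℝ => ((circleCurve n R, Ck.const k β + s • η) :
      Ck n Plane × Ck k ℝ)) (0, η) 0 := by
    refine (hasDerivAt_const _ _).prodMk ?_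
    simpa using ((hasDerivAt_id (0 : ℝ)).smul_const η).const_add (Ck.const k β)
  have hd' : HasFDerivAt (chordSq h) (fderiv ℝ (chordSq h) (circleCurve n R, Ck.const k β))
      (circleCurve n R, Ck.const k β + (0 : ℝ) • η) := by
    simpa using hd.hasFDerivAt
  have h1 := (Ck.eval k ℝ (x : S1)).hasFDerivAt.comp_hasDerivAt (0 : ℝ)
    (hd'.comp_hasDerivAt (0 : ℝ) hline)
  have h2 : HasDerivAt (fun s : ℝ => 2 * R ^ 2 * (1 - Real.cos (β + s * η (x : S1))))
      (2 * R ^ 2 * Real.sin β * η (x : S1)) 0 := by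
    have h3 : HasDerivAt (fun s : ℝ => β + s * η (x : S1)) (η (x : S1)) 0 := by
      simpa using ((hasDerivAt_id (0 : ℝ)).mul_const (η (x : S1))).const_add β
    have h4 := (h3.cos.const_sub 1).const_mul (2 * R ^ 2)
    exact h4.congr_deriv (by rw [zero_mul, add_zero]; ring)
  refine h1.unique (h2.congr_of_eventuallyEq (Eventually.of_forall fun s => ?_))
  change chordSq h _ (x : S1) = _
  rw [chordSq_apply]
  exact norm_sq_circleCurve_sub R x (β + s * η (x : S1))

/-- The intersection parameter near the circle, from the implicit function theorem. -/
theorem exists_intersection_param (k ℓ : ℕ) (hℓ : 1 ≤ ℓ) {r R β : ℝ} (hβ : R ^ 2 * Real.sin β ≠ 0)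
    (hr : 2 * R ^ 2 * (1 - Real.cos β) = r ^ 2) :
    ∃ T : Ck (k + ℓ + 1) Plane → Ck k ℝ,
      ContDiffAt ℝ ℓ T (circleCurve (k + ℓ + 1) R) ∧
      T (circleCurve (k + ℓ + 1) R) = Ck.const k β ∧
      ∀ᶠ γ in 𝓝 (circleCurve (k + ℓ + 1) R), ∀ φ : S1,
        ‖γ (φ + ((T γ φ : ℝ) : S1)) - γ φ‖ ^ 2 = r ^ 2 := by
  have h : k ≤ k + ℓ + 1 := by omega
  have hc : ContDiffAt ℝ ℓ (chordSq h) (circleCurve (k + ℓ + 1) R, Ck.const k β) :=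
    (contDiff_chordSq ℓ h le_rfl).contDiffAt
  have hℓ0 : (ℓ : WithTop ℕ∞) ≠ 0 := by exact_mod_cast (by omega : ℓ ≠ 0)
  have hinv : ((fderiv ℝ (chordSq h) (circleCurve (k + ℓ + 1) R, Ck.const k β)).comp
      (ContinuousLinearMap.inr ℝ (Ck (k + ℓ + 1) Plane) (Ck k ℝ))).IsInvertible := by
    rw [fderiv_chordSq_circleCurve h R β (hc.differentiableAt hℓ0)]
    refine isInvertible_smul_id ?_
    rw [mul_assoc]
    exact mul_ne_zero two_ne_zero hβ
  refine ⟨hc.implicitFunction hℓ0 hinv, hc.contDiffAt_implicitFunction hℓ0 hinv,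
    hc.implicitFunction_apply_self hℓ0 hinv, ?_⟩
  -- The implicit function keeps `chordSq` equal to its value at the base point, which is the
  -- constant `r²`.
  filter_upwards [hc.eventually_apply_implicitFunction hℓ0 hinv] with γ hγ φ
  have h1 := congrArg (fun f : Ck k ℝ => f φ) hγ
  simp only [chordSq_apply] at h1
  rw [h1, ← hr]
  induction φ using QuotientAddGroup.induction_on with
  | H x => exact norm_sq_circleCurve_sub R x β

/-- Implicit differentiation of the equation satisfied by an intersection parameter. -/
theorem fderiv_intersection_param {r : ℝ} {T : Ck (n + 1) Plane → Ck k ℝ}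
    {T' : Ck (n + 1) Plane →L[ℝ] Ck k ℝ} {γ : Ck (n + 1) Plane} (hT : HasFDerivAt T T' γ)
    (hev : ∀ᶠ γ' in 𝓝 γ, ∀ φ : S1, ‖γ' (φ + ((T γ' φ : ℝ) : S1)) - γ' φ‖ ^ 2 = r ^ 2) (φ : S1)
    (hne : inner ℝ (angDeriv 1 γ (φ + ((T γ φ : ℝ) : S1))) (γ (φ + ((T γ φ : ℝ) : S1)) - γ φ) ≠ 0)
    (σ : Ck (n + 1) Plane) :
    T' σ φ = inner ℝ (σ φ - σ (φ + ((T γ φ : ℝ) : S1))) (γ (φ + ((T γ φ : ℝ) : S1)) - γ φ) /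
      inner ℝ (angDeriv 1 γ (φ + ((T γ φ : ℝ) : S1))) (γ (φ + ((T γ φ : ℝ) : S1)) - γ φ) := by
  induction φ using QuotientAddGroup.induction_on with
  | H x =>
  have hline : HasDerivAt (fun s : ℝ => γ + s • σ) σ 0 := by
    simpa using ((hasDerivAt_id (0 : ℝ)).smul_const σ).const_add γ
  have hT0 : HasFDerivAt T T' (γ + (0 : ℝ) • σ) := by simpa using hT
  have hu : HasDerivAt (fun s : ℝ => T (γ + s • σ) (x : S1)) (T' σ (x : S1)) 0 :=
    (Ck.eval k ℝ (x : S1)).hasFDerivAt.comp_hasDerivAt (0 : ℝ) (hT0.comp_hasDerivAt (0 : ℝ) hline)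
  set u : ℝ → ℝ := fun s => T (γ + s • σ) (x : S1) with hu_def
  have hu0 : u 0 = T γ (x : S1) := by simp [hu_def]
  have hxu : HasDerivAt (fun s : ℝ => x + u s) (T' σ (x : S1)) 0 := hu.const_add x
  have hγ := (γ.hasDerivAt (x + u 0)).scomp (0 : ℝ) hxu
  have hσ := (σ.hasDerivAt (x + u 0)).scomp (0 : ℝ) hxu
  -- Derivative at `s = 0` of the chord of `γ + s • σ` from `x` to `x + u s`; its squared norm is
  -- constant near `0`.
  have he := (hγ.add ((hasDerivAt_id (0 : ℝ)).smul hσ)).sub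
    (((hasDerivAt_id (0 : ℝ)).smul_const (σ (x : S1))).const_add (γ (x : S1)))
  have hsq := he.norm_sq
  have hconst : HasDerivAt (fun _ : ℝ => r ^ 2) 0 (0 : ℝ) := hasDerivAt_const _ _
  have hzero := hsq.unique (hconst.congr_of_eventuallyEq ?_)
  · simp only [Pi.add_apply, Pi.sub_apply, Pi.smul_apply', Function.comp_apply, id_eq,
      zero_smul, add_zero, one_smul, zero_add, hu0] at hzero
    rw [eq_div_iff hne]
    change T' σ (x : S1) * inner ℝ (angDeriv 1 γ ((x + T γ (x : S1) : ℝ) : S1))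
      (γ ((x + T γ (x : S1) : ℝ) : S1) - γ (x : S1)) =
      inner ℝ (σ (x : S1) - σ ((x + T γ (x : S1) : ℝ) : S1))
      (γ ((x + T γ (x : S1) : ℝ) : S1) - γ (x : S1))
    set w := γ ((x + T γ (x : S1) : ℝ) : S1) - γ (x : S1)
    rw [inner_sub_right, inner_add_right, inner_smul_right] at hzero
    rw [inner_sub_left, real_inner_comm w, real_inner_comm w, real_inner_comm w]
    linarith
  · have htend : Tendsto (fun s : ℝ => γ + s • σ) (𝓝 0) (𝓝 γ) := by
      simpa using hline.continuousAt.tendsto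
    filter_upwards [htend.eventually hev] with s hs
    exact hs x

end Implicit

/-! ### Perturbation bounds for chords and inner products. -/

section Perturbation

variable {F : Type*} [NormedAddCommGroup F] [InnerProductSpace ℝ F] {v w v' w' : F} {M e : ℝ}

theorem abs_inner_le_mul {v w : F} {a b : ℝ} (hv : ‖v‖ ≤ a) (hw : ‖w‖ ≤ b) (ha : 0 ≤ a) :
    |inner ℝ v w| ≤ a * b :=
  (abs_real_inner_le_norm v w).trans (mul_le_mul hv hw (norm_nonneg w) ha)

/-- Here `v` is a chord of the circle and `w` one of the perturbation, whence the factors `2`. The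
next lemma uses the same, there not sharp, constant so that one radius serves both. -/
theorem abs_norm_add_sq_sub_le (hv : ‖v‖ ≤ 2 * M) (hw : ‖w‖ ≤ 2 * e) (hM : 0 ≤ M) (he : 0 ≤ e)
    (he1 : e ≤ 1) : |‖v + w‖ ^ 2 - ‖v‖ ^ 2| ≤ e * (8 * M + 4) := by
  have h : ‖v + w‖ ^ 2 - ‖v‖ ^ 2 = 2 * inner ℝ v w + inner ℝ w w := by
    rw [norm_add_sq_real, real_inner_self_eq_norm_sq]; ring
  have i1 := abs_inner_le_mul hv hw (by positivity)
  have i2 := abs_inner_le_mul hw hw (by positivity)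
  have i3 : e * e ≤ e := mul_le_of_le_one_right he he1
  rw [h]
  calc |2 * inner ℝ v w + inner ℝ w w| ≤ 2 * |inner ℝ v w| + |inner ℝ w w| := by
        refine (abs_add_le _ _).trans_eq ?_
        rw [abs_mul, abs_two]
    _ ≤ _ := by linarith

theorem abs_inner_add_sub_le (hv : ‖v‖ ≤ 2 * M) (hw : ‖w‖ ≤ 2 * e) (hv' : ‖v'‖ ≤ M)
    (hw' : ‖w'‖ ≤ e) (hM : 0 ≤ M) (he : 0 ≤ e) (he1 : e ≤ 1) :
    |inner ℝ (v' + w') (v + w) - inner ℝ v' v| ≤ e * (8 * M + 4) := by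
  have h : inner ℝ (v' + w') (v + w) - inner ℝ v' v =
      inner ℝ v' w + inner ℝ w' v + inner ℝ w' w := by
    rw [inner_add_left, inner_add_right, inner_add_right]; ring
  have i1 := abs_inner_le_mul hv' hw hM
  have i2 := abs_inner_le_mul hw' hv he
  have i3 := abs_inner_le_mul hw' hw he
  have i4 : e * e ≤ e := mul_le_of_le_one_right he he1
  rw [h]
  calc |inner ℝ v' w + inner ℝ w' v + inner ℝ w' w|
      ≤ |inner ℝ v' w| + |inner ℝ w' v| + |inner ℝ w' w| := abs_add_three _ _ _
    _ ≤ _ := by linarith [mul_nonneg he hM]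

end Perturbation

/-! ### All intersection parameters, and the two inverse diffeomorphisms. -/

section Geometry

variable {k n : ℕ}

theorem eventually_chord_close (R : ℝ) {ε : ℝ} (hε : 0 < ε) :
    ∀ᶠ γ : Ck (n + 1) Plane in 𝓝 (circleCurve (n + 1) R), ∀ x t : ℝ,
      |‖γ ((x + t : ℝ) : S1) - γ (x : S1)‖ ^ 2 - 2 * R ^ 2 * (1 - Real.cos t)| < ε ∧
      |inner ℝ (angDeriv 1 γ ((x + t : ℝ) : S1)) (γ ((x + t : ℝ) : S1) - γ (x : S1)) -
        R ^ 2 * Real.sin t| < ε := by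
  set γ₀ := circleCurve (n + 1) R
  set M := ‖γ₀‖
  have hM : 0 ≤ M := norm_nonneg _
  have hρ : 0 < min 1 (ε / (8 * M + 4)) := lt_min one_pos (by positivity)
  filter_upwards [Metric.ball_mem_nhds γ₀ hρ] with γ hγ x t
  rw [Metric.mem_ball, dist_eq_norm] at hγ
  set η := γ - γ₀ with hη
  have h1 : ‖η‖ ≤ 1 := (hγ.trans_le (min_le_left _ _)).le
  have h2 : ‖η‖ * (8 * M + 4) < ε := by
    rw [← lt_div_iff₀ (by positivity)]
    exact hγ.trans_le (min_le_right _ _)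
  have hγη : γ = γ₀ + η := by rw [hη]; abel
  rw [← norm_sq_circleCurve_sub (n := n + 1) R x t, ← inner_circleCurve (n := n + 1) R x t]
  change |_ - ‖γ₀ ((x + t : ℝ) : S1) - γ₀ (x : S1)‖ ^ 2| < ε ∧
    |_ - inner ℝ (angDeriv 1 γ₀ ((x + t : ℝ) : S1)) (γ₀ ((x + t : ℝ) : S1) - γ₀ (x : S1))| < ε
  have hd : γ ((x + t : ℝ) : S1) - γ (x : S1) = (γ₀ ((x + t : ℝ) : S1) - γ₀ (x : S1)) +
      (η ((x + t : ℝ) : S1) - η (x : S1)) := by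
    rw [hγη, Ck.add_apply, Ck.add_apply]
    abel
  have hD : angDeriv 1 γ ((x + t : ℝ) : S1) =
      angDeriv 1 γ₀ ((x + t : ℝ) : S1) + angDeriv 1 η ((x + t : ℝ) : S1) := by
    rw [← Ck.D_apply, ← Ck.D_apply, ← Ck.D_apply, ← Ck.add_apply, ← map_add, ← hγη]
  rw [hd, hD]
  have hv : ‖γ₀ ((x + t : ℝ) : S1) - γ₀ (x : S1)‖ ≤ 2 * M :=
    (norm_sub_le _ _).trans (by linarith [γ₀.norm_apply_le ((x + t : ℝ) : S1), γ₀.norm_apply_le x])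
  have hw : ‖η ((x + t : ℝ) : S1) - η (x : S1)‖ ≤ 2 * ‖η‖ :=
    (norm_sub_le _ _).trans (by linarith [η.norm_apply_le ((x + t : ℝ) : S1), η.norm_apply_le x])
  have hv' : ‖angDeriv 1 γ₀ ((x + t : ℝ) : S1)‖ ≤ M :=
    ((Ck.D γ₀).norm_apply_le _).trans γ₀.norm_D_le
  have hw' : ‖angDeriv 1 η ((x + t : ℝ) : S1)‖ ≤ ‖η‖ :=
    ((Ck.D η).norm_apply_le _).trans η.norm_D_le
  exact ⟨(abs_norm_add_sq_sub_le hv hw hM (norm_nonneg η) h1).trans_lt h2,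
    (abs_inner_add_sub_le hv hw hv' hw' hM (norm_nonneg η) h1).trans_lt h2⟩

theorem hasDerivAt_chord_sq (γ : Ck (n + 1) Plane) (x t : ℝ) :
    HasDerivAt (fun s : ℝ => ‖γ ((x + s : ℝ) : S1) - γ (x : S1)‖ ^ 2)
      (2 * inner ℝ (angDeriv 1 γ ((x + t : ℝ) : S1)) (γ ((x + t : ℝ) : S1) - γ (x : S1))) t := by
  have h1 : HasDerivAt (fun s : ℝ => x + s) 1 t := (hasDerivAt_id t).const_add x
  have h2 : HasDerivAt (fun s : ℝ => γ ((x + s : ℝ) : S1)) (angDeriv 1 γ ((x + t : ℝ) : S1)) t := by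
    have h3 := (γ.hasDerivAt (x + t)).scomp t h1
    rw [one_smul] at h3
    exact h3
  refine ((h2.sub_const (γ (x : S1))).norm_sq).congr_deriv ?_
  rw [real_inner_comm]

theorem min_sin_le_sin {c d t : ℝ} (hc : 0 ≤ c) (hd : d ≤ Real.pi) (ht : t ∈ Icc c d) :
    min (Real.sin c) (Real.sin d) ≤ Real.sin t :=
  strictConcaveOn_sin_Icc.concaveOn.min_le_of_mem_Icc
    ⟨hc, (ht.1.trans ht.2).trans hd⟩ ⟨hc.trans (ht.1.trans ht.2), hd⟩ ht

/-- The two functions `a` and `b` describe all intersection parameters of `γ`, relative to the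
base point; they take values near `α` and near `-α`, respectively. -/
structure IsIntersectionPair (γ : S1 → Plane) (r α δ : ℝ) (a b : S1 → ℝ) : Prop where
  a_mem : ∀ φ, a φ ∈ Ioo (α - δ) (α + δ)
  b_mem : ∀ φ, b φ ∈ Ioo (-α - δ) (-α + δ)
  dist_a : ∀ φ, dist (γ (φ + (a φ : S1))) (γ φ) = r
  dist_b : ∀ φ, dist (γ (φ + (b φ : S1))) (γ φ) = r
  eq_or_eq : ∀ φ, ∀ t ∈ Icc (-Real.pi) Real.pi, dist (γ (φ + (t : S1))) (γ φ) = r →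
    t = a φ ∨ t = b φ
  ne : ∀ φ, γ (φ + (a φ : S1)) ≠ γ (φ + (b φ : S1))
  inner_a_ne : ∀ φ,
    inner ℝ (angDeriv 1 γ (φ + (a φ : S1))) (γ (φ + (a φ : S1)) - γ φ) ≠ 0
  inner_b_ne : ∀ φ,
    inner ℝ (angDeriv 1 γ (φ + (b φ : S1))) (γ (φ + (b φ : S1)) - γ φ) ≠ 0

/-- The bounds `h1` and `h2` exclude offsets with `|t|` outside the `δ`-window around `α`; `h3`
fixes the sign of the derivative inside the windows, giving uniqueness and nonzero denominators;
`h4` keeps the two intersection points apart. -/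
theorem isIntersectionPair_of_close {r R α δ ε : ℝ} (hr : 0 < r) (hδ : 0 < δ)
    (hδα : δ < α) (hαδ : α + δ < Real.pi) (hα : 2 * R ^ 2 * (1 - Real.cos α) = r ^ 2)
    (h1 : ε ≤ 2 * R ^ 2 * (Real.cos (α - δ) - Real.cos α))
    (h2 : ε ≤ 2 * R ^ 2 * (Real.cos α - Real.cos (α + δ)))
    (h3 : ε ≤ R ^ 2 * min (Real.sin (α - δ)) (Real.sin (α + δ)))
    (h4 : ε ≤ 4 * R ^ 2 * min (Real.sin (α - δ)) (Real.sin (α + δ)) ^ 2)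
    {γ : Ck (n + 1) Plane} (hγ : ∀ x t : ℝ,
      |‖γ ((x + t : ℝ) : S1) - γ (x : S1)‖ ^ 2 - 2 * R ^ 2 * (1 - Real.cos t)| < ε ∧
      |inner ℝ (angDeriv 1 γ ((x + t : ℝ) : S1)) (γ ((x + t : ℝ) : S1) - γ (x : S1)) -
        R ^ 2 * Real.sin t| < ε)
    {a b : S1 → ℝ} (ha : ∀ φ, a φ ∈ Ioo (α - δ) (α + δ)) (hb : ∀ φ, b φ ∈ Ioo (-α - δ) (-α + δ))
    (har : ∀ φ, ‖γ (φ + (a φ : S1)) - γ φ‖ ^ 2 = r ^ 2)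
    (hbr : ∀ φ, ‖γ (φ + (b φ : S1)) - γ φ‖ ^ 2 = r ^ 2) :
    IsIntersectionPair γ r α δ a b := by
  have hR2 : 0 ≤ R ^ 2 := sq_nonneg R
  have hsin {t : ℝ} (ht : t ∈ Icc (α - δ) (α + δ)) : ε ≤ R ^ 2 * Real.sin t :=
    h3.trans (mul_le_mul_of_nonneg_left (min_sin_le_sin (by linarith) hαδ.le ht) hR2)
  have hpos (x : ℝ) {t : ℝ} (ht : t ∈ Icc (α - δ) (α + δ)) :
      0 < inner ℝ (angDeriv 1 γ ((x + t : ℝ) : S1)) (γ ((x + t : ℝ) : S1) - γ (x : S1)) := by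
    have := abs_lt.mp (hγ x t).2
    linarith [hsin ht]
  have hneg (x : ℝ) {t : ℝ} (ht : t ∈ Icc (-α - δ) (-α + δ)) :
      inner ℝ (angDeriv 1 γ ((x + t : ℝ) : S1)) (γ ((x + t : ℝ) : S1) - γ (x : S1)) < 0 := by
    have := abs_lt.mp (hγ x t).2
    have h5 := hsin (t := -t) ⟨by linarith [ht.2], by linarith [ht.1]⟩
    rw [Real.sin_neg] at h5
    linarith
  have hcont (x : ℝ) : Continuous fun s : ℝ => ‖γ ((x + s : ℝ) : S1) - γ (x : S1)‖ ^ 2 :=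
    continuous_iff_continuousAt.mpr fun t => (hasDerivAt_chord_sq γ x t).continuousAt
  have hdist (v w : Plane) (h : ‖v - w‖ ^ 2 = r ^ 2) : dist v w = r := by
    rw [dist_eq_norm]
    exact (sq_eq_sq₀ (norm_nonneg _) hr.le).mp h
  refine ⟨ha, hb, fun φ => hdist _ _ (har φ), fun φ => hdist _ _ (hbr φ), ?_, ?_, ?_, ?_⟩
  · intro φ t ht hd
    induction φ using QuotientAddGroup.induction_on with
    | H x =>
    have hft : ‖γ ((x + t : ℝ) : S1) - γ (x : S1)‖ ^ 2 = r ^ 2 := by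
      rw [← dist_eq_norm, ← hd]; rfl
    have hclose := abs_lt.mp (hγ x t).1
    have habs : |t| ≤ Real.pi := abs_le.mpr ht
    have hlow : α - δ < |t| := by
      by_contra! hle
      have := Real.cos_le_cos_of_nonneg_of_le_pi (abs_nonneg t) (by linarith) hle
      rw [Real.cos_abs] at this
      nlinarith
    have hhigh : |t| < α + δ := by
      by_contra! hle
      have := Real.cos_le_cos_of_nonneg_of_le_pi (by linarith) habs hle
      rw [Real.cos_abs] at this
      nlinarith
    rcases le_total 0 t with h0 | h0
    · left
      rw [abs_of_nonneg h0] at hlow hhigh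
      have hmono : StrictMonoOn (fun s : ℝ => ‖γ ((x + s : ℝ) : S1) - γ (x : S1)‖ ^ 2)
          (Icc (α - δ) (α + δ)) := by
        refine strictMonoOn_of_deriv_pos (convex_Icc _ _) (hcont x).continuousOn fun s hs => ?_
        rw [(hasDerivAt_chord_sq γ x s).deriv]
        linarith [hpos x (interior_subset hs)]
      exact hmono.injOn ⟨hlow.le, hhigh.le⟩ (Ioo_subset_Icc_self (ha x)) (hft.trans (har x).symm)
    · right
      rw [abs_of_nonpos h0] at hlow hhigh
      have hanti : StrictAntiOn (fun s : ℝ => ‖γ ((x + s : ℝ) : S1) - γ (x : S1)‖ ^ 2)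
          (Icc (-α - δ) (-α + δ)) := by
        refine strictAntiOn_of_deriv_neg (convex_Icc _ _) (hcont x).continuousOn fun s hs => ?_
        rw [(hasDerivAt_chord_sq γ x s).deriv]
        linarith [hneg x (interior_subset hs)]
      exact hanti.injOn ⟨by linarith, by linarith⟩ (Ioo_subset_Icc_self (hb x))
        (hft.trans (hbr x).symm)
  · intro φ heq
    induction φ using QuotientAddGroup.induction_on with
    | H x =>
    have hclose := abs_lt.mp (hγ (x + b x) (a x - b x)).1
    have e : x + b (x : S1) + (a (x : S1) - b (x : S1)) = x + a (x : S1) := by ring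
    have heq' : γ ((x + a (x : S1) : ℝ) : S1) = γ ((x + b (x : S1) : ℝ) : S1) := heq
    rw [e, heq', sub_self, norm_zero] at hclose
    -- The chord between the two points is compared with `2R²(1 - cos 2u) = 4R² sin² u`, and `u`
    -- lies in the window around `α`.
    set u := (a (x : S1) - b (x : S1)) / 2 with hu
    have hu2 : a (x : S1) - b (x : S1) = 2 * u := by rw [hu]; ring
    have hsu := min_sin_le_sin (c := α - δ) (d := α + δ) (t := u) (by linarith) hαδ.le
      ⟨by linarith [(ha x).1, (hb x).2], by linarith [(ha x).2, (hb x).1]⟩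
    have hs0 : 0 ≤ min (Real.sin (α - δ)) (Real.sin (α + δ)) :=
      le_min (Real.sin_nonneg_of_nonneg_of_le_pi (by linarith) (by linarith))
        (Real.sin_nonneg_of_nonneg_of_le_pi (by linarith) (by linarith))
    have hsq := pow_le_pow_left₀ hs0 hsu 2
    rw [hu2, Real.cos_two_mul'] at hclose
    have := Real.sin_sq_add_cos_sq u
    nlinarith
  · intro φ
    induction φ using QuotientAddGroup.induction_on with
    | H x => exact (hpos x (Ioo_subset_Icc_self (ha x))).ne'
  · intro φ
    induction φ using QuotientAddGroup.induction_on with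
    | H x => exact (hneg x (Ioo_subset_Icc_self (hb x))).ne

theorem coe_ne_zero_of_pos_of_lt {t : ℝ} (h0 : 0 < t) (h1 : t < 2 * Real.pi) : (t : S1) ≠ 0 := by
  intro ht
  have := AddCircle.coe_eq_coe_iff_of_mem_Ico (p := 2 * Real.pi) (a := 0) (x := t) (y := 0)
    ⟨h0.le, by simpa using h1⟩ ⟨le_rfl, by simpa using Real.two_pi_pos⟩
  rw [AddCircle.coe_zero] at this
  exact h0.ne' (this.mp ht)

theorem exists_add_coe (φ ψ : S1) : ∃ t ∈ Icc (-Real.pi) Real.pi, ψ = φ + ((t : ℝ) : S1) := by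
  obtain ⟨t, ht, he⟩ : ∃ t ∈ Ico (-Real.pi) (-Real.pi + 2 * Real.pi), (t : S1) = ψ - φ := by
    have := AddCircle.coe_image_Ico_eq (2 * Real.pi) (-Real.pi)
    have h2 : ψ - φ ∈ ((↑) : ℝ → S1) '' Ico (-Real.pi) (-Real.pi + 2 * Real.pi) := this ▸ mem_univ _
    exact h2
  exact ⟨t, ⟨ht.1, by linarith [ht.2]⟩, by rw [he]; abel⟩

namespace IsIntersectionPair

variable {γ : S1 → Plane} {r α δ : ℝ} {a b : S1 → ℝ}

theorem eq_add_or (h : IsIntersectionPair γ r α δ a b) {φ ψ : S1} (hd : dist (γ ψ) (γ φ) = r) :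
    ψ = φ + (a φ : S1) ∨ ψ = φ + (b φ : S1) := by
  obtain ⟨t, ht, rfl⟩ := exists_add_coe φ ψ
  rcases h.eq_or_eq φ t ht hd with rfl | rfl
  · exact Or.inl rfl
  · exact Or.inr rfl

theorem setOf_dist_eq (h : IsIntersectionPair γ r α δ a b) (φ : S1) :
    {ψ : S1 | dist (γ ψ) (γ φ) = r} = {φ + (a φ : S1), φ + (b φ : S1)} := by
  ext ψ
  constructor
  · exact fun hd => h.eq_add_or hd
  · rintro (rfl | rfl)
    · exact h.dist_a φ
    · exact h.dist_b φ

theorem sphere_inter_range (h : IsIntersectionPair γ r α δ a b) (φ : S1) :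
    Metric.sphere (γ φ) r ∩ range γ = {γ (φ + (a φ : S1)), γ (φ + (b φ : S1))} := by
  ext v
  constructor
  · rintro ⟨hv, ψ, rfl⟩
    rcases h.eq_add_or hv with rfl | rfl
    · exact Or.inl rfl
    · exact Or.inr rfl
  · rintro (rfl | rfl)
    · exact ⟨h.dist_a φ, mem_range_self _⟩
    · exact ⟨h.dist_b φ, mem_range_self _⟩

theorem isNextParam (h : IsIntersectionPair γ r α δ a b) (hδ : δ < α) (hα : α + δ < Real.pi)
    (φ : S1) : IsNextParam γ r φ (φ + (a φ : S1)) := by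
  have ha := h.a_mem φ
  have hb := h.b_mem φ
  refine ⟨a φ, ⟨by linarith [ha.1], by linarith [ha.2, Real.pi_pos]⟩, rfl, h.dist_a φ,
    fun s hs hd => ?_⟩
  rcases h.eq_or_eq φ s ⟨by linarith [hs.1, Real.pi_pos], by linarith [hs.2, ha.2]⟩ hd with he | he
  · exact hs.2.ne he
  · linarith [hs.1, hb.2]

theorem isPrevParam (h : IsIntersectionPair γ r α δ a b) (hδ : δ < α) (hα : α + δ < Real.pi)
    (φ : S1) : IsPrevParam γ r φ (φ + (b φ : S1)) := by
  have ha := h.a_mem φ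
  have hb := h.b_mem φ
  refine ⟨-b φ, ⟨by linarith [hb.2], by linarith [hb.1, Real.pi_pos]⟩, ?_, h.dist_b φ,
    fun s hs hd => ?_⟩
  · rw [AddCircle.coe_neg, sub_neg_eq_add]
  rw [sub_eq_add_neg, ← AddCircle.coe_neg] at hd
  rcases h.eq_or_eq φ (-s) ⟨by linarith [hs.2, hb.1], by linarith [hs.1, Real.pi_pos]⟩ hd
    with he | he
  · linarith [hs.1, ha.1]
  · linarith [hs.2]

/-- By symmetry of the distance, `φ` is an intersection parameter for `φ + a φ`. It cannot be the
forward one, since two forward steps add up to an offset strictly between `0` and `2π`. -/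
theorem left_inv (h : IsIntersectionPair γ r α δ a b) (hδ : δ < α) (hα : α + δ < Real.pi)
    (φ : S1) : φ + (a φ : S1) + (b (φ + (a φ : S1)) : S1) = φ := by
  rcases h.eq_add_or ((dist_comm _ _).trans (h.dist_a φ)) with he | he
  · exfalso
    refine coe_ne_zero_of_pos_of_lt (t := a φ + a (φ + (a φ : S1))) ?_ ?_ ?_
    · linarith [(h.a_mem φ).1, (h.a_mem (φ + (a φ : S1))).1]
    · linarith [(h.a_mem φ).2, (h.a_mem (φ + (a φ : S1))).2]
    · rw [AddCircle.coe_add]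
      rw [add_assoc] at he
      exact left_eq_add.mp he
  · exact he.symm

theorem right_inv (h : IsIntersectionPair γ r α δ a b) (hδ : δ < α) (hα : α + δ < Real.pi)
    (φ : S1) : φ + (b φ : S1) + (a (φ + (b φ : S1)) : S1) = φ := by
  rcases h.eq_add_or ((dist_comm _ _).trans (h.dist_b φ)) with he | he
  · exact he.symm
  · exfalso
    refine coe_ne_zero_of_pos_of_lt (t := -(b φ + b (φ + (b φ : S1)))) ?_ ?_ ?_
    · linarith [(h.b_mem φ).2, (h.b_mem (φ + (b φ : S1))).2]
    · linarith [(h.b_mem φ).1, (h.b_mem (φ + (b φ : S1))).1]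
    · rw [AddCircle.coe_neg, AddCircle.coe_add, neg_eq_zero]
      rw [add_assoc] at he
      exact left_eq_add.mp he

end IsIntersectionPair

theorem isCkMap_add (a : Ck k ℝ) : IsCkMap k fun φ => φ + ((a φ : ℝ) : S1) :=
  ⟨fun x => x + a (x : S1), contDiff_id.add a.contDiff, fun _ => rfl⟩

/-- The diffeomorphism `φ ↦ φ + a φ` with inverse `φ ↦ φ + b φ`. -/
def Diff.ofShift (a b : Ck k ℝ)
    (h1 : ∀ φ : S1, φ + ((a φ : ℝ) : S1) + ((b (φ + ((a φ : ℝ) : S1)) : ℝ) : S1) = φ)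
    (h2 : ∀ φ : S1, φ + ((b φ : ℝ) : S1) + ((a (φ + ((b φ : ℝ) : S1)) : ℝ) : S1) = φ) : Diff k where
  toEquiv := ⟨fun φ => φ + ((a φ : ℝ) : S1), fun φ => φ + ((b φ : ℝ) : S1), h1, h2⟩
  isCk := isCkMap_add a
  isCk_symm := isCkMap_add b

instance : Nonempty (Diff k) :=
  ⟨Equiv.refl S1, ⟨id, contDiff_id, fun _ => rfl⟩, ⟨id, contDiff_id, fun _ => rfl⟩⟩

theorem isLocalRep_of_eq_add {X : Type*} [NormedAddCommGroup X] [NormedSpace ℝ X] {P : X → Diff k}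
    {T : X → Ck k ℝ} {x₀ : X} (h : ∀ᶠ x in 𝓝 x₀, ∀ φ : S1, P x φ = φ + ((T x φ : ℝ) : S1)) :
    IsLocalRep P x₀ fun x => T x - T x₀ := by
  refine ⟨sub_self _, ?_⟩
  filter_upwards [h] with x hx φ
  rw [hx, h.self_of_nhds, Ck.sub_apply, AddCircle.coe_sub]
  abel

end Geometry

/-! ### Choice of the constants and of the neighborhood. -/

/-- The angle under which the circle of radius `r` about a point of the circle of radius `R` meets
the latter. -/
theorem exists_angle {r R : ℝ} (hr : 0 < r) (hR : r / 2 < R) :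
    ∃ α, 0 < α ∧ α < Real.pi ∧ 2 * R ^ 2 * (1 - Real.cos α) = r ^ 2 := by
  have hR0 : 0 < R := by linarith
  have hq0 : 0 < r ^ 2 / (2 * R ^ 2) := by positivity
  -- This is where `R > r / 2` matters: the argument of `arccos` stays above `-1`, so `α < π`.
  have hq1 : r ^ 2 / (2 * R ^ 2) < 2 := by
    rw [div_lt_iff₀ (by positivity)]
    nlinarith
  refine ⟨Real.arccos (1 - r ^ 2 / (2 * R ^ 2)), Real.arccos_pos.mpr (by linarith), ?_, ?_⟩
  · refine lt_of_le_of_ne (Real.arccos_le_pi _) fun h => ?_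
    rw [Real.arccos_eq_pi] at h
    linarith
  · rw [Real.cos_arccos (by linarith) (by linarith)]
    field_simp
    ring

theorem exists_intersection_neighborhood (k ℓ : ℕ) (hℓ : 1 ≤ ℓ) {r R : ℝ} (hr : 0 < r)
    (hR : r / 2 < R) :
    ∃ (α δ : ℝ) (V : Set (Ck (k + ℓ + 1) Plane)) (A B : Ck (k + ℓ + 1) Plane → Ck k ℝ),
      δ < α ∧ α + δ < Real.pi ∧ IsOpen V ∧ circleCurve (k + ℓ + 1) R ∈ V ∧
      ∀ γ ∈ V, IsIntersectionPair γ r α δ (A γ) (B γ) ∧ ContDiffAt ℝ ℓ A γ ∧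
        ContDiffAt ℝ ℓ B γ := by
  obtain ⟨α, hα0, hαπ, hα⟩ := exists_angle hr hR
  have hR2 : 0 < R ^ 2 := by
    have : 0 < R := by linarith
    positivity
  have hsin : 0 < Real.sin α := Real.sin_pos_of_pos_of_lt_pi hα0 hαπ
  obtain ⟨A, hA, hA0, hAr⟩ := exists_intersection_param k ℓ hℓ (β := α)
    (mul_pos hR2 hsin).ne' hα
  obtain ⟨B, hB, hB0, hBr⟩ := exists_intersection_param k ℓ hℓ (R := R) (r := r) (β := -α)
    (by rw [Real.sin_neg]; exact mul_ne_zero hR2.ne' (neg_ne_zero.mpr hsin.ne'))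
    (by rwa [Real.cos_neg])
  obtain ⟨δ, hδ, hδα, hαδ⟩ : ∃ δ, 0 < δ ∧ δ < α ∧ α + δ < Real.pi := by
    -- Half the distance from `α` to the ends of `[0, π]` keeps the window inside, where the sine is
    -- positive.
    refine ⟨min α (Real.pi - α) / 2, ?_, ?_, ?_⟩
    · have : 0 < min α (Real.pi - α) := lt_min hα0 (by linarith)
      linarith
    · linarith [min_le_left α (Real.pi - α)]
    · linarith [min_le_right α (Real.pi - α)]
  have hc1 : Real.cos α < Real.cos (α - δ) :=
    Real.cos_lt_cos_of_nonneg_of_le_pi (by linarith) hαπ.le (by linarith)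
  have hc2 : Real.cos (α + δ) < Real.cos α :=
    Real.cos_lt_cos_of_nonneg_of_le_pi hα0.le hαδ.le (by linarith)
  have hs : 0 < min (Real.sin (α - δ)) (Real.sin (α + δ)) :=
    lt_min (Real.sin_pos_of_pos_of_lt_pi (by linarith) (by linarith))
      (Real.sin_pos_of_pos_of_lt_pi (by linarith) hαδ)
  set s := min (Real.sin (α - δ)) (Real.sin (α + δ)) with hs_def
  obtain ⟨ε, hε, h1, h2, h3, h4⟩ : ∃ ε, 0 < ε ∧
      ε ≤ 2 * R ^ 2 * (Real.cos (α - δ) - Real.cos α) ∧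
      ε ≤ 2 * R ^ 2 * (Real.cos α - Real.cos (α + δ)) ∧ ε ≤ R ^ 2 * s ∧ ε ≤ 4 * R ^ 2 * s ^ 2 := by
    refine ⟨min (min (2 * R ^ 2 * (Real.cos (α - δ) - Real.cos α))
      (2 * R ^ 2 * (Real.cos α - Real.cos (α + δ)))) (min (R ^ 2 * s) (4 * R ^ 2 * s ^ 2)),
      lt_min (lt_min (mul_pos (by positivity) (by linarith)) (mul_pos (by positivity) (by linarith)))
        (lt_min (by positivity) (by positivity)),
      (min_le_left _ _).trans (min_le_left _ _), (min_le_left _ _).trans (min_le_right _ _),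
      (min_le_right _ _).trans (min_le_left _ _), (min_le_right _ _).trans (min_le_right _ _)⟩
  have near {T : Ck (k + ℓ + 1) Plane → Ck k ℝ} {β : ℝ}
      (hT : ContDiffAt ℝ ℓ T (circleCurve (k + ℓ + 1) R))
      (hT0 : T (circleCurve (k + ℓ + 1) R) = Ck.const k β) :
      ∀ᶠ γ in 𝓝 (circleCurve (k + ℓ + 1) R), ∀ φ, T γ φ ∈ Ioo (β - δ) (β + δ) := by
    filter_upwards [hT.continuousAt.eventually (Metric.ball_mem_nhds _ hδ)] with γ hγ φ
    rw [hT0, dist_eq_norm] at hγ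
    have h5 : |T γ φ - β| < δ := ((T γ - Ck.const k β).norm_apply_le φ).trans_lt hγ
    rw [abs_lt] at h5
    exact ⟨by linarith [h5.1], by linarith [h5.2]⟩
  have hgood : ∀ᶠ γ : Ck (k + ℓ + 1) Plane in 𝓝 (circleCurve (k + ℓ + 1) R),
      IsIntersectionPair γ r α δ (A γ) (B γ) ∧ ContDiffAt ℝ ℓ A γ ∧ ContDiffAt ℝ ℓ B γ := by
    -- Being `Cˡ` at a point, for finite `ℓ`, persists at nearby points, so smoothness at the circle
    -- gives smoothness on a whole neighborhood.
    filter_upwards [near hA hA0, near hB hB0, hAr, hBr, eventually_chord_close R hε,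
      hA.eventually (by simp), hB.eventually (by simp)] with γ g1 g2 g3 g4 g5 g6 g7
    exact ⟨isIntersectionPair_of_close hr hδ hδα hαδ hα h1 h2 h3 h4 g5 g1 g2 g3 g4, g6, g7⟩
  obtain ⟨V, hV, hVo, hVm⟩ := eventually_nhds_iff.mp hgood
  exact ⟨α, δ, V, A, B, hδα, hαδ, hVo, hVm, hV⟩

end CircInv

end

theorem mainTheorem4 (k ℓ : ℕ) (hℓ : 1 ≤ ℓ) (r R : ℝ) (hr : 0 < r) (hR : r / 2 < R) :
    ∃ V : Set (CircInv.Ck (k + ℓ + 1) CircInv.Plane),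
      IsOpen V ∧ CircInv.circleCurve (k + ℓ + 1) R ∈ V ∧
      ∃ p m : CircInv.Ck (k + ℓ + 1) CircInv.Plane → CircInv.Diff k,
        (∀ γ ∈ V, ∀ φ : CircInv.S1,
          Metric.sphere (γ φ) r ∩ Set.range γ = {γ (p γ φ), γ (m γ φ)} ∧
          γ (p γ φ) ≠ γ (m γ φ) ∧
          {ψ : CircInv.S1 | dist (γ ψ) (γ φ) = r} = {p γ φ, m γ φ} ∧
          CircInv.IsNextParam γ r φ (p γ φ) ∧
          CircInv.IsPrevParam γ r φ (m γ φ)) ∧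
        (∀ γ ∈ V, CircInv.DiffContDiffAt ℓ p γ ∧ CircInv.DiffContDiffAt ℓ m γ) ∧
        (∀ γ ∈ V, ∃ p' m' : CircInv.Ck (k + ℓ + 1) CircInv.Plane →L[ℝ] CircInv.Ck k ℝ,
          CircInv.DiffHasFDerivAt p p' γ ∧
          CircInv.DiffHasFDerivAt m m' γ ∧
          ∀ φ : CircInv.S1,
            inner ℝ (CircInv.angDeriv 1 γ (p γ φ)) (γ (p γ φ) - γ φ) ≠ 0 ∧
            inner ℝ (CircInv.angDeriv 1 γ (m γ φ)) (γ (m γ φ) - γ φ) ≠ 0 ∧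
            ∀ σ : CircInv.Ck (k + ℓ + 1) CircInv.Plane,
              p' σ φ = inner ℝ (σ φ - σ (p γ φ)) (γ (p γ φ) - γ φ) /
                inner ℝ (CircInv.angDeriv 1 γ (p γ φ)) (γ (p γ φ) - γ φ) ∧
              m' σ φ = inner ℝ (σ φ - σ (m γ φ)) (γ (m γ φ) - γ φ) /
                inner ℝ (CircInv.angDeriv 1 γ (m γ φ)) (γ (m γ φ) - γ φ)) := by
  obtain ⟨α, δ, V, A, B, hδα, hαδ, hVo, hV0, hV⟩ :=
    CircInv.exists_intersection_neighborhood k ℓ hℓ hr hR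
  have exP (γ : CircInv.Ck (k + ℓ + 1) CircInv.Plane) : ∃ P : CircInv.Diff k,
      γ ∈ V → ∀ φ : CircInv.S1, P φ = φ + ((A γ φ : ℝ) : CircInv.S1) := by
    by_cases h : γ ∈ V
    · exact ⟨CircInv.Diff.ofShift (A γ) (B γ) ((hV γ h).1.left_inv hδα hαδ)
        ((hV γ h).1.right_inv hδα hαδ), fun _ _ => rfl⟩
    -- Off `V` the value is irrelevant: every claim concerns points of the open set `V`, and the
    -- charts only see nearby curves.
    · exact ⟨Classical.arbitrary _, fun h' => absurd h' h⟩
  have exM (γ : CircInv.Ck (k + ℓ + 1) CircInv.Plane) : ∃ P : CircInv.Diff k,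
      γ ∈ V → ∀ φ : CircInv.S1, P φ = φ + ((B γ φ : ℝ) : CircInv.S1) := by
    by_cases h : γ ∈ V
    · exact ⟨CircInv.Diff.ofShift (B γ) (A γ) ((hV γ h).1.right_inv hδα hαδ)
        ((hV γ h).1.left_inv hδα hαδ), fun _ _ => rfl⟩
    · exact ⟨Classical.arbitrary _, fun h' => absurd h' h⟩
  choose p hp using exP
  choose m hm using exM
  have hℓ0 : (ℓ : WithTop ℕ∞) ≠ 0 := by exact_mod_cast (by omega : ℓ ≠ 0)
  have repP {γ} (hγ : γ ∈ V) : CircInv.IsLocalRep p γ fun x => A x - A γ :=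
    CircInv.isLocalRep_of_eq_add (by filter_upwards [hVo.mem_nhds hγ] with x hx using hp x hx)
  have repM {γ} (hγ : γ ∈ V) : CircInv.IsLocalRep m γ fun x => B x - B γ :=
    CircInv.isLocalRep_of_eq_add (by filter_upwards [hVo.mem_nhds hγ] with x hx using hm x hx)
  refine ⟨V, hVo, hV0, p, m, fun γ hγ φ => ?_, fun γ hγ => ?_, fun γ hγ => ?_⟩
  · have h := (hV γ hγ).1
    rw [hp γ hγ φ, hm γ hγ φ]
    exact ⟨h.sphere_inter_range φ, h.ne φ, h.setOf_dist_eq φ, h.isNextParam hδα hαδ φ,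
      h.isPrevParam hδα hαδ φ⟩
  · exact ⟨⟨_, repP hγ, (hV γ hγ).2.1.sub contDiffAt_const⟩,
      ⟨_, repM hγ, (hV γ hγ).2.2.sub contDiffAt_const⟩⟩
  · have hA := ((hV γ hγ).2.1.differentiableAt hℓ0).hasFDerivAt
    have hB := ((hV γ hγ).2.2.differentiableAt hℓ0).hasFDerivAt
    have h := (hV γ hγ).1
    refine ⟨fderiv ℝ A γ, fderiv ℝ B γ, ⟨_, repP hγ, hA.sub_const _⟩,
      ⟨_, repM hγ, hB.sub_const _⟩, fun φ => ?_⟩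
    rw [hp γ hγ φ, hm γ hγ φ]
    refine ⟨h.inner_a_ne φ, h.inner_b_ne φ, fun σ => ⟨?_, ?_⟩⟩
    · refine CircInv.fderiv_intersection_param (r := r) hA ?_ φ (h.inner_a_ne φ) σ
      filter_upwards [hVo.mem_nhds hγ] with x hx ψ
      rw [← dist_eq_norm, (hV x hx).1.dist_a ψ]
    · refine CircInv.fderiv_intersection_param (r := r) hB ?_ φ (h.inner_b_ne φ) σ
      filter_upwards [hVo.mem_nhds hγ] with x hx ψ
      rw [← dist_eq_norm, (hV x hx).1.dist_b ψ]
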